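/- All graphs are finite and loopless and may have parallel edges. For a connected graph $G=(V,E)$ with Laplacian $Q$, a divisor is a vector $D\in\mathbb Z^V$; its degree is $\sum_v D(v)$, and it is effective if $D\ge 0$. Divisors $D,D'$ are equivalent if $D'=D-Qx$ for some $x\in\mathbb Z^V$. The rank of $D$ is $-1$ if $D$ is not equivalent to an effective divisor, and otherwise the largest $r\ge 0$ such that $D-F$ is equivalent to an effective divisor for every effective divisor $F$ of degree at most $r$. The divisorial gonality $\operatorname{dgon}(G)$ is the minimum degree of a divisor of rank at least $1$. Theorem. There is an algorithm that, given a connected graph $G$ (as a list of edges) and an effective divisor $D$ on $G$ of rank at least $1$ (with its values written in binary), outputs a tree decomposition of $G$ of width at most $k=\deg(D)$, in time polynomial in the length of the input. (Time is counted on a uniform-cost random access machine with addition and subtraction but without multiplication; the length of the input is the total binary length of its numbers.) Consequently, the treewidth of every connected graph $G$ is at most $\operatorname{dgon}(G)$. -/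

import Mathlib

/-! ### Multigraphs, divisors, gonality -/

/-- A multigraph without loops on the vertex set `V`: a finite multiset of edges, each of which is
an unordered pair of distinct vertices. -/
structure Multigraph (V : Type*) where
  edges : Multiset (Sym2 V)
  loopless : ∀ e ∈ edges, ¬ e.IsDiag

namespace Multigraph

variable {V : Type*}

/-- The underlying simple graph. -/
def toSimpleGraph (G : Multigraph V) : SimpleGraph V where
  Adj u v := s(u, v) ∈ G.edges
  symm := ⟨fun u v h => by rwa [Sym2.eq_swap]⟩
  loopless := ⟨fun v h => G.loopless _ h (Sym2.mk_isDiag_iff.2 rfl)⟩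

/-- Connectedness (this includes that there is at least one vertex). -/
def Connected (G : Multigraph V) : Prop := G.toSimpleGraph.Connected

variable [DecidableEq V]

/-- The number of edges between `u` and `v`. -/
def mult (G : Multigraph V) (u v : V) : ℕ := G.edges.count s(u, v)

/-- The number of edges with `v` as an end. -/
def vertexDegree (G : Multigraph V) (v : V) : ℕ := (G.edges.filter (fun e => v ∈ e)).card

/-- The Laplacian matrix. -/
def laplacian (G : Multigraph V) : Matrix V V ℤ :=
  Matrix.of fun u v => if u = v then (G.vertexDegree u : ℤ) else -(G.mult u v : ℤ)

variable [Fintype V]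

/-- Equivalence of divisors: `D' = D - Q x` for an integer vector `x`. -/
def DivisorEquiv (G : Multigraph V) (D D' : V → ℤ) : Prop :=
  ∃ x : V → ℤ, D' = D - G.laplacian.mulVec x

end Multigraph

/-- The degree of a divisor. -/
def divisorDegree {V : Type*} [Fintype V] (D : V → ℤ) : ℤ := ∑ v, D v

/-- A divisor is effective if it has no negative entries. -/
def IsEffective {V : Type*} (D : V → ℤ) : Prop := ∀ v, 0 ≤ D v

namespace Multigraph

variable {V : Type*} [DecidableEq V] [Fintype V]

/-- The divisor is equivalent to an effective one. -/
def EquivEffective (G : Multigraph V) (D : V → ℤ) : Prop :=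
  ∃ D' : V → ℤ, G.DivisorEquiv D D' ∧ IsEffective D'

open Classical in
/-- The rank of a divisor: `-1` if it is not equivalent to an effective divisor, and otherwise the
largest `k` such that `D - E` is equivalent to an effective divisor for every effective `E` of
degree at most `k` (on a nonempty vertex set these `k` are bounded by the degree of `D`). -/
noncomputable def rank (G : Multigraph V) (D : V → ℤ) : ℤ :=
  if G.EquivEffective D then
    ((sSup {k : ℕ | ∀ E : V → ℤ, IsEffective E → divisorDegree E ≤ k →
      G.EquivEffective (D - E)} : ℕ) : ℤ)
  else -1

/-- The divisorial gonality: the minimum degree of a divisor of rank at least `1`. -/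
noncomputable def dgon (G : Multigraph V) : ℤ :=
  sInf {k : ℤ | ∃ D : V → ℤ, 1 ≤ G.rank D ∧ divisorDegree D = k}

end Multigraph

/-! ### Tree decompositions -/

/-- `(T, X)` is a tree decomposition of the multigraph `G`. -/
structure IsTreeDecomposition {V I : Type*} (G : Multigraph V) (T : SimpleGraph I)
    (X : I → Finset V) : Prop where
  isTree : T.IsTree
  exists_mem_bag : ∀ v, ∃ i, v ∈ X i
  exists_edge_bag : ∀ u v, s(u, v) ∈ G.edges → ∃ i, u ∈ X i ∧ v ∈ X i
  connected_nodes : ∀ v, (T.induce {i | v ∈ X i}).Connected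

/-- The width of a family of bags: the largest size of a bag, minus one. -/
def bagWidth {V I : Type*} [Fintype I] (X : I → Finset V) : ℤ :=
  ((Finset.univ.sup fun i => (X i).card : ℕ) : ℤ) - 1

/-- The treewidth: the minimum width of a (finite) tree decomposition. -/
noncomputable def Multigraph.treewidth {V : Type*} (G : Multigraph V) : ℤ :=
  sInf {w : ℤ | ∃ (N : ℕ) (T : SimpleGraph (Fin N)) (X : Fin N → Finset V),
    IsTreeDecomposition G T X ∧ bagWidth X = w}

/-! ### Random access machines

A random access machine with natural number registers, addition and truncated subtraction, indirect
addressing, an input tape and an output tape, under the uniform cost criterion. There is no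
multiplication, so the lengths of all numbers stay linear in the input size plus the number of
steps, and polynomial time is the usual notion. Control flow is structured. -/

namespace RAM

/-- A state: scalar registers, arrays, the unread input and the output written so far. -/
structure State where
  reg : ℕ → ℕ
  arr : ℕ → ℕ → ℕ
  inp : List ℕ
  out : List ℕ

/-- Expressions: constants, registers, array entries, sums, truncated differences. -/
inductive Expr where
  | const (c : ℕ)
  | var (x : ℕ)
  | get (a : ℕ) (i : Expr)
  | add (e f : Expr)
  | sub (e f : Expr)

namespace Expr

/-- The value of an expression. -/
def eval (s : State) : Expr → ℕ
  | const c => c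
  | var x => s.reg x
  | get a i => s.arr a (i.eval s)
  | add e f => e.eval s + f.eval s
  | sub e f => e.eval s - f.eval s

/-- The cost of evaluating an expression: the number of operations in it. -/
def cost : Expr → ℕ
  | const _ => 1
  | var _ => 1
  | get _ i => i.cost + 1
  | add e f => e.cost + f.cost + 1
  | sub e f => e.cost + f.cost + 1

end Expr

/-- Programs. Tests are expressions; a test succeeds if its value is nonzero. -/
inductive Program where
  | skip
  | assign (x : ℕ) (e : Expr)
  | store (a : ℕ) (i e : Expr)
  | read (x : ℕ)
  | write (e : Expr)
  | seq (p q : Program)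
  | ite (e : Expr) (p q : Program)
  | while (e : Expr) (p : Program)

namespace State

/-- Put the value `c` into register `x`. -/
def setReg (s : State) (x c : ℕ) : State := { s with reg := Function.update s.reg x c }

/-- Put the value `c` into entry `i` of array `a`. -/
def setArr (s : State) (a i c : ℕ) : State :=
  { s with arr := Function.update s.arr a (Function.update (s.arr a) i c) }

/-- Move the next input number (`0` if the input is exhausted) into register `x`. -/
def readReg (s : State) (x : ℕ) : State :=
  { s with reg := Function.update s.reg x (s.inp.headD 0), inp := s.inp.tail }

/-- Append `c` to the output. -/
def emit (s : State) (c : ℕ) : State := { s with out := s.out ++ [c] }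

/-- The initial state on input `w`: all registers and array entries are `0`. -/
def init (w : List ℕ) : State := ⟨fun _ => 0, fun _ _ => 0, w, []⟩

end State

/-- `Exec p s t s'`: program `p`, started in state `s`, halts after `t` steps in state `s'`. -/
inductive Exec : Program → State → ℕ → State → Prop
  | skip (s : State) : Exec .skip s 1 s
  | assign (x : ℕ) (e : Expr) (s : State) :
      Exec (.assign x e) s (e.cost + 1) (s.setReg x (e.eval s))
  | store (a : ℕ) (i e : Expr) (s : State) :
      Exec (.store a i e) s (i.cost + e.cost + 1) (s.setArr a (i.eval s) (e.eval s))
  | read (x : ℕ) (s : State) : Exec (.read x) s 1 (s.readReg x)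
  | write (e : Expr) (s : State) : Exec (.write e) s (e.cost + 1) (s.emit (e.eval s))
  | seq {p q : Program} {s s' s'' : State} {t t' : ℕ} :
      Exec p s t s' → Exec q s' t' s'' → Exec (.seq p q) s (t + t') s''
  | ite_true {e : Expr} {p q : Program} {s s' : State} {t : ℕ} :
      e.eval s ≠ 0 → Exec p s t s' → Exec (.ite e p q) s (e.cost + 1 + t) s'
  | ite_false {e : Expr} {p q : Program} {s s' : State} {t : ℕ} :
      e.eval s = 0 → Exec q s t s' → Exec (.ite e p q) s (e.cost + 1 + t) s'
  | while_false {e : Expr} {p : Program} {s : State} :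
      e.eval s = 0 → Exec (.while e p) s (e.cost + 1) s
  | while_true {e : Expr} {p : Program} {s s' s'' : State} {t t' : ℕ} :
      e.eval s ≠ 0 → Exec p s t s' → Exec (.while e p) s' t' s'' →
      Exec (.while e p) s (e.cost + 1 + t + t') s''

/-- Program `p` on input `w` halts after `t` steps with output `o`. -/
def Program.Computes (p : Program) (w : List ℕ) (t : ℕ) (o : List ℕ) : Prop :=
  ∃ s : State, Exec p (State.init w) t s ∧ s.out = o

/-- The size of an input: the total length of its numbers in binary, counting one delimiter for
each number. -/
def bitSize (w : List ℕ) : ℕ := (w.map fun x => Nat.size x + 1).sum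

/-- The program `p`, on every input in `S`, halts within a number of steps that is polynomial in the
size of the input, with an output that `R` relates to the input. -/
def Program.SolvesInPolyTime (p : Program) {ι : Type*} (S : Set ι) (encode : ι → List ℕ)
    (R : ι → List ℕ → Prop) : Prop :=
  ∃ b : Polynomial ℕ, ∀ x ∈ S, ∃ (t : ℕ) (o : List ℕ),
    p.Computes (encode x) t o ∧ t ≤ b.eval (bitSize (encode x)) ∧ R x o

end RAM

/-! ### The computational problem -/

/-- An input: a list of edges (each given by its two ends, in either order) on the vertices
`0, …, n - 1`, and a divisor. Parallel edges are listed repeatedly. -/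
structure DivisorInput where
  n : ℕ
  edgeList : List (Fin n × Fin n)
  edgeList_ne : ∀ e ∈ edgeList, e.1 ≠ e.2
  divisor : Fin n → ℤ

namespace DivisorInput

/-- The multigraph that is given by the list of edges. -/
def graph (x : DivisorInput) : Multigraph (Fin x.n) where
  edges := (x.edgeList.map fun e => s(e.1, e.2) : List (Sym2 (Fin x.n)))
  loopless := fun e he => by
    obtain ⟨f, hf, rfl⟩ := List.mem_map.1 (Multiset.mem_coe.1 he)
    exact fun h => x.edgeList_ne f hf (Sym2.mk_isDiag_iff.1 h)

/-- The encoding of an input: the numbers of vertices and edges, the ends of the edges, and the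
values of the divisor (which are natural numbers if the divisor is effective). -/
def encode (x : DivisorInput) : List ℕ :=
  x.n :: x.edgeList.length :: (x.edgeList.flatMap fun e => [e.1.val, e.2.val]) ++
    (List.finRange x.n).map fun v => (x.divisor v).toNat

/-- The admissible inputs: a connected multigraph and an effective divisor of positive rank. -/
def admissible : Set DivisorInput :=
  {x | x.graph.Connected ∧ IsEffective x.divisor ∧ 1 ≤ x.graph.rank x.divisor}

end DivisorInput

/-- An explicit tree with bags: the nodes `0, …, N - 1`, a list of the edges of the tree and, for
every node, a list of the vertices in its bag. -/
structure TreeWithBags (n : ℕ) where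
  N : ℕ
  treeEdges : List (Fin N × Fin N)
  bagList : Fin N → List (Fin n)

namespace TreeWithBags

variable {n : ℕ}

/-- The graph on the nodes. -/
def tree (d : TreeWithBags n) : SimpleGraph (Fin d.N) :=
  SimpleGraph.fromEdgeSet {e | ∃ f ∈ d.treeEdges, e = s(f.1, f.2)}

/-- The bag of a node. -/
def bag (d : TreeWithBags n) (i : Fin d.N) : Finset (Fin n) := (d.bagList i).toFinset

/-- The encoding: the numbers of nodes and edges, the ends of the edges, and for every node the
length of the list of its bag, followed by that list. -/
def encode (d : TreeWithBags n) : List ℕ :=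
  d.N :: d.treeEdges.length :: (d.treeEdges.flatMap fun f => [f.1.val, f.2.val]) ++
    (List.finRange d.N).flatMap fun i => (d.bagList i).length :: (d.bagList i).map Fin.val

end TreeWithBags

/-- The output `o` encodes a tree decomposition of the input graph whose width is at most the degree
of the input divisor. -/
def IsSmallDecomposition (x : DivisorInput) (o : List ℕ) : Prop :=
  ∃ d : TreeWithBags x.n, d.encode = o ∧ IsTreeDecomposition x.graph d.tree d.bag ∧
    bagWidth d.bag ≤ divisorDegree x.divisor

/-! For a vertex `w`, play a chip-firing game towards `w`: burn from `w` by Dhar's rule, fire all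
unburnt vertices, and repeat until `w` holds a chip. Let τ(w) be the number of rounds. If E = D - Qx
is effective with a chip on `w`, the top level set of x above x(w) never burns, so each round lowers
max x - x(w). A cut argument bounds the variation of x along an edge by deg D. Hence τ(w) ≤ n · deg
D (`exists_isHit`).

Order the vertices by τ, breaking ties arbitrarily. The bag of v consists of v and the boundary of
its component C in the graph on the vertices not before v; its parent is the latest boundary vertex.
This is a tree decomposition for every order (`elimTree_isTreeDecomposition`), so it remains to
bound the boundary by deg D (`card_boundary_le`). Two facts about neighbours carry this. Adjacent
chipless vertices ignite each other, so they have the same fire and their games agree until one of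
them is hit (`chipSeq_eq_of_adj`); thus all of C plays the game of v. And a vertex hit before its
neighbour keeps a chip until that neighbour is hit (`chipSeq_pos_of_adj`). Take the chips f one
round before v is hit and the burnt set B, which contains C. A boundary vertex hit earlier holds a
chip of f. One hit together with v lies in B without a chip, but has an edge leaving B. A vertex
outside B has a chip for each of its edges into B, and these chips pay for both kinds of edges,
those to C and those to boundary vertices of the second kind.

If deg D ≥ n, the width bound is trivial. So the games may be cut off after n² rounds, and the time
is polynomial although chips are given in binary. For the program, a Hoare-style logic bounds the
time by a polynomial, read off from the syntax, in the largest number of iterations of a loop. -/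

/-! ### Program logic -/

namespace RAM

namespace Program

/-- Whether the program may change the register `x`. -/
def modReg : Program → ℕ → Bool
  | skip, _ => false
  | assign y _, x => y == x
  | store _ _ _, _ => false
  | read y, x => y == x
  | write _, _ => false
  | seq p q, x => p.modReg x || q.modReg x
  | ite _ p q, x => p.modReg x || q.modReg x
  | .while _ p, x => p.modReg x

/-- Whether the program may change the array `a`. -/
def modArr : Program → ℕ → Bool
  | skip, _ => false
  | assign _ _, _ => false
  | store b _ _, a => b == a
  | read _, _ => false
  | write _, _ => false
  | seq p q, a => p.modArr a || q.modArr a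
  | ite _ p q, a => p.modArr a || q.modArr a
  | .while _ p, a => p.modArr a

/-- Whether the program may read input. -/
def reads : Program → Bool
  | read _ => true
  | seq p q => p.reads || q.reads
  | ite _ p q => p.reads || q.reads
  | .while _ p => p.reads
  | _ => false

/-- Whether the program may write output. -/
def writes : Program → Bool
  | write _ => true
  | seq p q => p.writes || q.writes
  | ite _ p q => p.writes || q.writes
  | .while _ p => p.writes
  | _ => false

/-- A bound for the number of steps, as a polynomial in the maximal number of iterations of a
loop. -/
noncomputable def timePoly : Program → Polynomial ℕ
  | skip => 1
  | assign _ e => Polynomial.C (e.cost + 1)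
  | store _ i e => Polynomial.C (i.cost + e.cost + 1)
  | read _ => 1
  | write e => Polynomial.C (e.cost + 1)
  | seq p q => p.timePoly + q.timePoly
  | ite e p q => Polynomial.C (e.cost + 1) + p.timePoly + q.timePoly
  | .while e p => Polynomial.X * (Polynomial.C (e.cost + 1) + p.timePoly) + Polynomial.C (e.cost + 1)

/-- Run `p` with `i = 0, 1, …, b - 1`, where `b` is a register. -/
def forLoop (i b : ℕ) (p : Program) : Program :=
  .seq (.assign i (.const 0))
    (.while (.sub (.var b) (.var i)) (.seq p (.assign i (.add (.var i) (.const 1)))))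

end Program

/-- `s'` agrees with `s` on everything that `p` does not mention as a target. -/
structure Frame (p : Program) (s s' : State) : Prop where
  reg : ∀ x, p.modReg x = false → s'.reg x = s.reg x
  arr : ∀ a, p.modArr a = false → s'.arr a = s.arr a
  inp : p.reads = false → s'.inp = s.inp
  out : p.writes = false → s'.out = s.out

theorem Frame.refl (p : Program) (s : State) : Frame p s s :=
  ⟨fun _ _ => rfl, fun _ _ => rfl, fun _ => rfl, fun _ => rfl⟩

theorem Frame.trans {p : Program} {s s' s'' : State} (h : Frame p s s') (h' : Frame p s' s'') :
    Frame p s s'' :=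
  ⟨fun x hx => (h'.reg x hx).trans (h.reg x hx), fun a ha => (h'.arr a ha).trans (h.arr a ha),
    fun hp => (h'.inp hp).trans (h.inp hp), fun hp => (h'.out hp).trans (h.out hp)⟩

theorem Frame.mono {p q : Program} {s s' : State} (h : Frame p s s')
    (hr : ∀ x, q.modReg x = false → p.modReg x = false)
    (ha : ∀ x, q.modArr x = false → p.modArr x = false)
    (hi : q.reads = false → p.reads = false) (ho : q.writes = false → p.writes = false) :
    Frame q s s' :=
  ⟨fun x hx => h.reg x (hr x hx), fun x hx => h.arr x (ha x hx), fun hp => h.inp (hi hp),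
    fun hp => h.out (ho hp)⟩

/-- The footprint tests compute, so later an untouched register or array is a matter of `rfl`, and
invariants mention only what a loop changes. -/
theorem Exec.frame {p : Program} {s s' : State} {t : ℕ} (h : Exec p s t s') : Frame p s s' := by
  induction h with
  | skip s => exact .refl _ _
  | assign x e s =>
    refine ⟨fun y hy => ?_, fun _ _ => rfl, fun _ => rfl, fun _ => rfl⟩
    have : y ≠ x := by rintro rfl; simp [Program.modReg] at hy
    simp [State.setReg, this]
  | store a i e s =>
    refine ⟨fun _ _ => rfl, fun y hy => ?_, fun _ => rfl, fun _ => rfl⟩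
    have : y ≠ a := by rintro rfl; simp [Program.modArr] at hy
    simp [State.setArr, this]
  | read x s =>
    refine ⟨fun y hy => ?_, fun _ _ => rfl, fun h => by simp [Program.reads] at h, fun _ => rfl⟩
    have : y ≠ x := by rintro rfl; simp [Program.modReg] at hy
    simp [State.readReg, this]
  | write e s =>
    exact ⟨fun _ _ => rfl, fun _ _ => rfl, fun _ => rfl, fun h => by simp [Program.writes] at h⟩
  | seq h h' ih ih' =>
    exact (ih.mono (by simp +contextual [Program.modReg]) (by simp +contextual [Program.modArr])
      (by simp +contextual [Program.reads]) (by simp +contextual [Program.writes])).trans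
      (ih'.mono (by simp +contextual [Program.modReg]) (by simp +contextual [Program.modArr])
      (by simp +contextual [Program.reads]) (by simp +contextual [Program.writes]))
  | ite_true he h ih =>
    exact ih.mono (by simp +contextual [Program.modReg]) (by simp +contextual [Program.modArr])
      (by simp +contextual [Program.reads]) (by simp +contextual [Program.writes])
  | ite_false he h ih =>
    exact ih.mono (by simp +contextual [Program.modReg]) (by simp +contextual [Program.modArr])
      (by simp +contextual [Program.reads]) (by simp +contextual [Program.writes])
  | while_false he => exact .refl _ _
  | while_true he h h' ih ih' =>
    exact (ih.mono (by simp [Program.modReg]) (by simp [Program.modArr])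
      (by simp [Program.reads]) (by simp [Program.writes])).trans ih'

/-- Started in `s`, the program `p` halts within the time that `timePoly` allows for loops with at
most `L` iterations, in a state that satisfies `Q`. -/
def WP (L : ℕ) (p : Program) (s : State) (Q : State → Prop) : Prop :=
  ∃ t s', Exec p s t s' ∧ t ≤ p.timePoly.eval L ∧ Q s'

namespace WP

variable {L : ℕ} {p q : Program} {s : State} {Q Q' : State → Prop}

theorem mono (h : WP L p s Q) (hQ : ∀ s', Frame p s s' → Q s' → Q' s') : WP L p s Q' := by
  obtain ⟨t, s', he, ht, hq⟩ := h
  exact ⟨t, s', he, ht, hQ s' he.frame hq⟩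

theorem skip (h : Q s) : WP L .skip s Q :=
  ⟨1, s, .skip s, by simp [Program.timePoly], h⟩

theorem assign {x : ℕ} {e : Expr} (h : Q (s.setReg x (e.eval s))) : WP L (.assign x e) s Q :=
  ⟨_, _, .assign x e s, by simp [Program.timePoly], h⟩

theorem store {a : ℕ} {i e : Expr} (h : Q (s.setArr a (i.eval s) (e.eval s))) :
    WP L (.store a i e) s Q :=
  ⟨_, _, .store a i e s, by simp [Program.timePoly], h⟩

theorem read {x : ℕ} (h : Q (s.readReg x)) : WP L (.read x) s Q :=
  ⟨_, _, .read x s, by simp [Program.timePoly], h⟩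

theorem write {e : Expr} (h : Q (s.emit (e.eval s))) : WP L (.write e) s Q :=
  ⟨_, _, .write e s, by simp [Program.timePoly], h⟩

theorem seq (h : WP L p s fun s' => WP L q s' Q) : WP L (.seq p q) s Q := by
  obtain ⟨t, s', he, ht, t', s'', he', ht', hq⟩ := h
  exact ⟨t + t', s'', .seq he he', by simp [Program.timePoly]; omega, hq⟩

theorem ite {e : Expr} (h : e.eval s ≠ 0 → WP L p s Q) (h' : e.eval s = 0 → WP L q s Q) :
    WP L (.ite e p q) s Q := by
  by_cases he : e.eval s = 0
  · obtain ⟨t, s', hx, ht, hq⟩ := h' he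
    exact ⟨_, s', .ite_false he hx, by simp [Program.timePoly]; omega, hq⟩
  · obtain ⟨t, s', hx, ht, hq⟩ := h he
    exact ⟨_, s', .ite_true he hx, by simp [Program.timePoly]; omega, hq⟩

/-- Indexing the invariant by the number of completed iterations gives termination together with
correctness; `N ≤ L` lets `timePoly` pay for the loop. -/
theorem while_count {e : Expr} (I : ℕ → State → Prop) (N : ℕ) (hN : N ≤ L)
    (hb : ∀ j < N, ∀ s', I j s' → e.eval s' ≠ 0 ∧ WP L p s' (I (j + 1)))
    (hend : ∀ s', I N s' → e.eval s' = 0) (h0 : I 0 s) : WP L (.while e p) s (I N) := by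
  -- Induction on the number `d` of iterations still to come; the last summand pays for the failing
  -- test.
  have key : ∀ d ≤ N, ∀ s', I (N - d) s' → ∃ t s'', Exec (.while e p) s' t s'' ∧
      t ≤ d * (e.cost + 1 + p.timePoly.eval L) + (e.cost + 1) ∧ I N s'' := by
    intro d
    induction d with
    | zero => exact fun _ s' h => ⟨_, s', .while_false (hend s' h), by simp, h⟩
    | succ d ih =>
      intro hd s' h
      obtain ⟨he, t, s₁, hx, ht, h₁⟩ := hb (N - (d + 1)) (by omega) s' h
      rw [show N - (d + 1) + 1 = N - d by omega] at h₁
      obtain ⟨t', s₂, hx', ht', h₂⟩ := ih (by omega) s₁ h₁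
      exact ⟨_, s₂, .while_true he hx hx', by rw [add_mul]; omega, h₂⟩
  obtain ⟨t, s', hx, ht, h⟩ := key N le_rfl s (by simpa using h0)
  refine ⟨t, s', hx, ht.trans ?_, h⟩
  simp only [Program.timePoly, Polynomial.eval_add, Polynomial.eval_mul, Polynomial.eval_X,
    Polynomial.eval_C]
  gcongr

/-- The rule for counting loops. -/
theorem forLoop {i b : ℕ} (I : ℕ → State → Prop) (N : ℕ) (hN : N ≤ L) (hbN : s.reg b = N)
    (hib : b ≠ i) (hmb : p.modReg b = false) (hmi : p.modReg i = false)
    (hI : ∀ j s c, I j s → I j (s.setReg i c)) (h0 : I 0 s)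
    (hb : ∀ j < N, ∀ s', Frame (Program.forLoop i b p) s s' → s'.reg i = j → I j s' →
      WP L p s' (I (j + 1))) :
    WP L (Program.forLoop i b p) s (I N) := by
  have hmod : (Program.forLoop i b p).modReg b = false := by
    simpa [Program.forLoop, Program.modReg, hmb] using hib.symm
  refine seq (assign ?_)
  refine (while_count (fun j s' => I j s' ∧ s'.reg i = j ∧ Frame (Program.forLoop i b p) s s') N hN
    ?_ ?_ ⟨hI _ _ _ h0, by simp [State.setReg, Expr.eval], ?_⟩).mono fun s' _ h => h.1
  · rintro j hj s' ⟨hIj, hi, hF⟩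
    -- Subtraction is truncated, so the test `b - i` is nonzero exactly when `i < b`.
    refine ⟨by simp only [Expr.eval, hi, hF.reg b hmod]; omega, seq ?_⟩
    refine (hb j hj s' hF hi hIj).mono fun s'' hF' h => assign ⟨hI _ _ _ h, ?_, hF.trans ?_⟩
    · simp [State.setReg, Expr.eval, hF'.reg i hmi, hi]
    · refine (hF'.mono ?_ ?_ ?_ ?_).trans
        ((Exec.assign i (.add (.var i) (.const 1)) s'').frame.mono ?_ ?_ ?_ ?_) <;>
      simp +contextual [Program.forLoop, Program.modReg, Program.modArr, Program.reads,
        Program.writes]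
  · rintro s' ⟨-, hi, hF⟩
    simp only [Expr.eval, hi, hF.reg b hmod]; omega
  · refine (Exec.assign i (.const 0) s).frame.mono ?_ ?_ ?_ ?_ <;>
      simp +contextual [Program.forLoop, Program.modReg, Program.modArr, Program.reads,
        Program.writes]

end WP

end RAM

/-! ### Burning and firing -/

open Finset

/-- Iterating an inflationary operation on finite sets as often as there are elements leads to a
fixed point. -/
theorem Finset.iterate_card_fixed {α : Type*} [Fintype α] (g : Finset α → Finset α)
    (hg : ∀ s, s ⊆ g s) (s : Finset α) :
    g (g^[Fintype.card α] s) = g^[Fintype.card α] s := by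
  -- Until it stabilises, every application adds an element.
  have h : ∀ r, g (g^[r] s) = g^[r] s ∨ r ≤ #(g^[r] s) := by
    intro r
    induction r with
    | zero => simp
    | succ r ih =>
      rw [Function.iterate_succ_apply']
      by_cases hr : g (g^[r] s) = g^[r] s
      · left; rw [hr, hr]
      · have := card_lt_card ((hg (g^[r] s)).ssubset_of_ne (Ne.symm hr))
        right
        rcases ih with ih | ih
        · exact absurd ih hr
        · omega
  rcases h (Fintype.card α) with h | h
  · exact h
  · rw [(card_eq_iff_eq_univ _).1 (le_antisymm (card_le_univ _) h)]
    exact (subset_univ _).antisymm (hg _)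

namespace Multigraph

variable {V : Type*} [DecidableEq V] (G : Multigraph V)

/-! ### Edge counts and the Laplacian -/

theorem mult_comm (u v : V) : G.mult u v = G.mult v u := by
  simp only [mult, Sym2.eq_swap]

theorem mult_self (v : V) : G.mult v v = 0 :=
  Multiset.count_eq_zero.2 fun h => G.loopless _ h (Sym2.mk_isDiag_iff.2 rfl)

theorem mult_pos_iff {u v : V} : 0 < G.mult u v ↔ G.toSimpleGraph.Adj u v := Multiset.count_pos

variable [Fintype V]

theorem sum_mult (v : V) : ∑ u, G.mult v u = G.vertexDegree v := by
  unfold mult vertexDegree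
  induction G.edges using Multiset.induction_on with
  | empty => simp
  | cons e s ih =>
    simp only [Multiset.count_cons, sum_add_distrib, ih]
    by_cases h : v ∈ e
    · rw [Multiset.filter_cons_of_pos (p := fun e => v ∈ e) _ h, Multiset.card_cons]
      obtain ⟨y, rfl⟩ := h
      simp only [Sym2.congr_right, sum_ite_eq', mem_univ, if_true]
    · rw [Multiset.filter_cons_of_neg (p := fun e => v ∈ e) _ h, sum_eq_zero, add_zero]
      intro u _
      rw [if_neg]
      rintro rfl
      exact h (Sym2.mem_mk_left v u)

theorem laplacian_mulVec (x : V → ℤ) (v : V) :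
    G.laplacian.mulVec x v = ∑ u, (G.mult v u : ℤ) * (x v - x u) := by
  have h : ∀ u, G.laplacian v u * x u =
      (if v = u then (G.vertexDegree v : ℤ) * x v else 0) - (G.mult v u : ℤ) * x u := by
    intro u
    by_cases h : v = u
    · subst h; simp [laplacian, mult_self]
    · simp [laplacian, h]
  simp only [Matrix.mulVec, dotProduct, h, sum_sub_distrib, mul_sub, ← sum_mul]
  simp [← sum_mult]

/-- The sum of the Laplacian over a set of vertices is a sum over the edges that leave the set. -/
theorem sum_laplacian_mulVec (x : V → ℤ) (A : Finset V) :
    ∑ v ∈ A, G.laplacian.mulVec x v = ∑ v ∈ A, ∑ u ∈ Aᶜ, (G.mult v u : ℤ) * (x v - x u) := by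
  -- Inside `A` the summand is antisymmetric in its two vertices.
  have h : ∑ v ∈ A, ∑ u ∈ A, (G.mult v u : ℤ) * (x v - x u) = 0 := by
    have : ∑ v ∈ A, ∑ u ∈ A, (G.mult v u : ℤ) * (x v - x u) =
        -∑ v ∈ A, ∑ u ∈ A, (G.mult v u : ℤ) * (x v - x u) := by
      conv_lhs => rw [sum_comm]
      rw [← sum_neg_distrib]
      refine sum_congr rfl fun v _ => ?_
      rw [← sum_neg_distrib]
      refine sum_congr rfl fun u _ => ?_
      rw [G.mult_comm u v]; ring
    omega
  calc ∑ v ∈ A, G.laplacian.mulVec x v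
      = ∑ v ∈ A, (∑ u ∈ A, (G.mult v u : ℤ) * (x v - x u) +
          ∑ u ∈ Aᶜ, (G.mult v u : ℤ) * (x v - x u)) := by
        refine sum_congr rfl fun v _ => ?_
        rw [laplacian_mulVec, sum_add_sum_compl]
    _ = _ := by rw [sum_add_distrib, h, zero_add]

theorem sum_univ_laplacian_mulVec (x : V → ℤ) : ∑ v, G.laplacian.mulVec x v = 0 := by
  rw [sum_laplacian_mulVec]; simp

/-- The number of edges from `v` to `S`. -/
def edgesTo (S : Finset V) (v : V) : ℕ := ∑ u ∈ S, G.mult v u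

omit [Fintype V] in
theorem edgesTo_mono {S S' : Finset V} (h : S ⊆ S') (v : V) : G.edgesTo S v ≤ G.edgesTo S' v :=
  sum_le_sum_of_subset h

theorem edgesTo_add_compl (S : Finset V) (v : V) :
    G.edgesTo S v + G.edgesTo Sᶜ v = G.vertexDegree v := by
  rw [edgesTo, edgesTo, sum_add_sum_compl, sum_mult]

theorem edgesTo_le (S : Finset V) (v : V) : G.edgesTo S v ≤ G.vertexDegree v := by
  rw [← edgesTo_add_compl _ S]; omega

omit [Fintype V] in
theorem vertexDegree_le (v : V) : G.vertexDegree v ≤ G.edges.card :=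
  Multiset.card_le_card (Multiset.filter_le _ _)

omit [Fintype V] in
theorem edgesTo_pos_iff {S : Finset V} {v : V} :
    0 < G.edgesTo S v ↔ ∃ u ∈ S, G.toSimpleGraph.Adj u v := by
  rw [edgesTo, sum_pos_iff]
  simp only [mult_comm G v, mult_pos_iff]

/-! ### Dhar's burning rule -/

/-- One round of Dhar's burning algorithm: a vertex burns if it has fewer chips than edges to the
burnt vertices. -/
def burnStep (f : V → ℕ) (S : Finset V) : Finset V := S ∪ univ.filter fun v => f v < G.edgesTo S v

/-- The vertices that burn if a fire starts at `w`. -/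
def burnSet (f : V → ℕ) (w : V) : Finset V := (G.burnStep f)^[Fintype.card V] {w}

theorem subset_burnStep (f : V → ℕ) (S : Finset V) : S ⊆ G.burnStep f S := subset_union_left

theorem mem_burnSet_self (f : V → ℕ) (w : V) : w ∈ G.burnSet f w := by
  have : ∀ r, w ∈ (G.burnStep f)^[r] {w} := by
    intro r
    induction r with
    | zero => simp
    | succ r ih => rw [Function.iterate_succ_apply']; exact G.subset_burnStep f _ ih
  exact this _

variable {G}

theorem edgesTo_burnSet_le {f : V → ℕ} {w v : V} (h : v ∉ G.burnSet f w) :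
    G.edgesTo (G.burnSet f w) v ≤ f v := by
  by_contra! hlt
  apply h
  have := Finset.iterate_card_fixed (G.burnStep f) (G.subset_burnStep f) {w}
  rw [burnSet, ← this]
  exact mem_union_right _ (mem_filter.2 ⟨mem_univ v, hlt⟩)

theorem burnSet_induction {f : V → ℕ} {w : V} {P : V → Prop} (hw : P w)
    (h : ∀ S v, (∀ u ∈ S, P u) → f v < G.edgesTo S v → P v) : ∀ v ∈ G.burnSet f w, P v := by
  have : ∀ r, ∀ v ∈ (G.burnStep f)^[r] {w}, P v := by
    intro r
    induction r with
    | zero => simpa using hw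
    | succ r ih =>
      rw [Function.iterate_succ_apply']
      intro v hv
      rcases mem_union.1 hv with hv | hv
      · exact ih v hv
      · exact h _ v ih (by simpa using hv)
  exact this _

/-- Vertices that can afford to fire together stay unburnt: the first of them to burn would have
fewer chips than edges leaving the set. -/
theorem disjoint_burnSet {f : V → ℕ} {w : V} {A : Finset V} (hw : w ∉ A)
    (h : ∀ v ∈ A, G.edgesTo Aᶜ v ≤ f v) {v : V} (hv : v ∈ A) : v ∉ G.burnSet f w := by
  intro hb
  refine burnSet_induction (P := (· ∉ A)) hw (fun S v hS hlt hv => ?_) v hb hv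
  exact absurd (h v hv) (not_le.2 (hlt.trans_le (G.edgesTo_mono (fun u hu => by
    simpa using hS u hu) v)))

/-- The rule is monotone in the burnt set, so a fire that has reached `b` burns all that a fire from
`b` alone burns. -/
theorem burnSet_subset {f : V → ℕ} {a b : V} (h : b ∈ G.burnSet f a) :
    G.burnSet f b ⊆ G.burnSet f a := by
  refine burnSet_induction h fun S v hS hlt => ?_
  by_contra hv
  exact absurd (edgesTo_burnSet_le hv) (not_le.2 (hlt.trans_le (G.edgesTo_mono hS v)))

theorem mem_burnSet_of_adj {f : V → ℕ} {w a b : V} (ha : a ∈ G.burnSet f w)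
    (h : G.toSimpleGraph.Adj a b) (hb : f b = 0) : b ∈ G.burnSet f w := by
  by_contra hv
  have := edgesTo_burnSet_le hv
  have := G.edgesTo_pos_iff.2 ⟨a, ha, h⟩
  omega

/-- Each chipless end catches fire from the other. This couples the games towards adjacent vertices.
-/
theorem burnSet_eq_of_adj {f : V → ℕ} {a b : V} (h : G.toSimpleGraph.Adj a b) (ha : f a = 0)
    (hb : f b = 0) : G.burnSet f a = G.burnSet f b :=
  (burnSet_subset (mem_burnSet_of_adj (G.mem_burnSet_self f b) h.symm ha)).antisymm
    (burnSet_subset (mem_burnSet_of_adj (G.mem_burnSet_self f a) h hb))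

variable (G)

/-! ### Firing the unburnt set -/

/-- Fire the set of all vertices that do not burn if a fire starts at `w`. -/
def fire (w : V) (f : V → ℕ) (v : V) : ℕ :=
  if v ∈ G.burnSet f w then f v + G.vertexDegree v - G.edgesTo (G.burnSet f w) v
  else f v - G.edgesTo (G.burnSet f w) v

/-- The indicator vector of the vertices that do not burn. -/
def unburnt (w : V) (f : V → ℕ) (v : V) : ℤ := if v ∈ G.burnSet f w then 0 else 1

/-- The subtractions in `fire` never truncate: an unburnt vertex has a chip for each edge to the
fire, and a burnt one has at most its degree many such edges. -/
theorem coe_fire (w : V) (f : V → ℕ) (v : V) :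
    (G.fire w f v : ℤ) = f v - G.laplacian.mulVec (G.unburnt w f) v := by
  have h : G.laplacian.mulVec (G.unburnt w f) v =
      G.edgesTo (G.burnSet f w) v - if v ∈ G.burnSet f w then (G.vertexDegree v : ℤ) else 0 := by
    have hs : (G.edgesTo (G.burnSet f w) v : ℤ) =
        ∑ u, (G.mult v u : ℤ) * if u ∈ G.burnSet f w then 1 else 0 := by
      simp [edgesTo]
    rw [laplacian_mulVec, hs, ← sum_mult]
    split_ifs with hv
    · push_cast
      rw [← sum_sub_distrib]
      refine sum_congr rfl fun u _ => ?_
      simp only [unburnt, hv]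
      split_ifs <;> ring
    · rw [sub_zero]
      refine sum_congr rfl fun u _ => ?_
      simp only [unburnt, hv, if_false]
      split_ifs <;> ring
  rw [h, fire]
  split_ifs with hv
  · have := G.edgesTo_le (G.burnSet f w) v
    omega
  · have := edgesTo_burnSet_le hv
    omega

theorem sum_fire (w : V) (f : V → ℕ) : ∑ v, G.fire w f v = ∑ v, f v := by
  zify
  simp [coe_fire, sum_univ_laplacian_mulVec]

theorem fire_of_mem {w : V} {f : V → ℕ} {v : V} (h : v ∈ G.burnSet f w) :
    G.fire w f v = f v + G.edgesTo (G.burnSet f w)ᶜ v := by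
  rw [fire, if_pos h, ← G.edgesTo_add_compl (G.burnSet f w) v]; omega

/-- The chips after `i` rounds of firing towards `w`. -/
def chipSeq (D : V → ℕ) (w : V) (i : ℕ) : V → ℕ := (G.fire w)^[i] D

theorem chipSeq_succ (D : V → ℕ) (w : V) (i : ℕ) :
    G.chipSeq D w (i + 1) = G.fire w (G.chipSeq D w i) := Function.iterate_succ_apply' _ _ _

theorem sum_chipSeq (D : V → ℕ) (w : V) (i : ℕ) : ∑ v, G.chipSeq D w i v = ∑ v, D v := by
  induction i with
  | zero => rfl
  | succ i ih => rw [chipSeq_succ, sum_fire, ih]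

/-! ### The number of rounds -/

/-- If an effective divisor with a chip on `w` can be reached, then firing towards `w` puts a chip
on `w` after a number of rounds that is bounded by the variation of the firing script. -/
theorem exists_chipSeq_pos {w : V} {E : V → ℤ} (hE : IsEffective E) (hw : 0 < E w) (N : ℕ)
    (f : V → ℕ) (x : V → ℤ) (hx : ∀ v, E v = f v - G.laplacian.mulVec x v)
    (hN : ∀ v, x v ≤ x w + N) : ∃ i ≤ N, 0 < G.chipSeq f w i w := by
  induction N generalizing f x with
  | zero =>
    -- The script is maximal at `w`, so it can only take chips from `w`, which therefore has one
    -- already.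
    refine ⟨0, le_rfl, ?_⟩
    have h := hx w
    have : 0 ≤ G.laplacian.mulVec x w := by
      rw [laplacian_mulVec]
      refine sum_nonneg fun u _ => mul_nonneg (by positivity) ?_
      have := hN u
      push_cast at this
      omega
    change 0 < f w
    omega
  | succ N ih =>
    -- After a round, the fired set is removed from the script; `w` burns, so `x w` stays as it is.
    obtain ⟨i, hi, h⟩ := ih (G.fire w f) (x - G.unburnt w f) (fun v => by
      rw [coe_fire, Matrix.mulVec_sub, Pi.sub_apply, hx v]; ring) (fun v => by
      have hxv := hN v
      have hw1 : G.unburnt w f w = 0 := by simp [unburnt, mem_burnSet_self]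
      simp only [Pi.sub_apply, hw1]
      push_cast at hxv
      by_cases hv : v ∈ G.burnSet f w
      · rcases eq_or_lt_of_le hxv with h | h
        -- The top level set of the script can fire because `E` is effective, so it does not burn
        -- and its values drop by one.
        · refine absurd hv (disjoint_burnSet (A := {u | x u = x w + N + 1}) (by simp; omega) ?_
            (by simp; omega))
          intro u hu
          have hu : x u = x w + N + 1 := by simpa using hu
          have hle : (G.edgesTo ({u | x u = x w + N + 1} : Finset V)ᶜ u : ℤ) ≤
              G.laplacian.mulVec x u := by
            rw [laplacian_mulVec, edgesTo, ← sum_add_sum_compl {u | x u = x w + N + 1}]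
            push_cast
            refine le_add_of_nonneg_of_le (sum_nonneg fun z _ => mul_nonneg (by positivity) ?_)
              (sum_le_sum fun z hz => le_mul_of_one_le_right (by positivity) ?_)
            · have := hN z
              push_cast at this
              omega
            · have := hN z
              simp at hz
              push_cast at this
              omega
          have := hx u
          have := hE u
          omega
        · simp only [unburnt, hv, if_true]; omega
      · simp only [unburnt, hv, if_false]; omega)
    exact ⟨i + 1, by omega, h⟩

/-- A firing script between effective divisors varies by at most the degree along every edge. -/
theorem sub_le_of_adj {E x : V → ℤ} {f : V → ℕ} (hE : IsEffective E)
    (hx : ∀ v, E v = f v - G.laplacian.mulVec x v) {a b : V} (h : G.toSimpleGraph.Adj a b) :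
    x a ≤ x b + (∑ v, f v : ℕ) := by
  rcases le_or_gt (x a) (x b) with hab | hab
  · have : (0 : ℤ) ≤ (∑ v, f v : ℕ) := by positivity
    omega
  -- Across the cut given by the upper level set of `a` all terms are nonnegative, and the edge to
  -- `b` alone contributes at least `x a - x b`.
  have h1 : x a - x b ≤ ∑ v ∈ {v | x a ≤ x v}, G.laplacian.mulVec x v := by
    rw [sum_laplacian_mulVec]
    have hnn : ∀ v ∈ ({v | x a ≤ x v} : Finset V), ∀ u ∈ ({v | x a ≤ x v} : Finset V)ᶜ,
        0 ≤ (G.mult v u : ℤ) * (x v - x u) := by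
      intro v hv u hu
      simp at hv hu
      exact mul_nonneg (by positivity) (by omega)
    refine le_trans ?_ (single_le_sum (fun v hv => sum_nonneg (hnn v hv)) (a := a) (by simp))
    refine le_trans ?_ (single_le_sum (fun u hu => hnn a (by simp) u hu) (a := b) (by simpa))
    have := G.mult_pos_iff.2 h
    exact le_mul_of_one_le_left (by omega) (by exact_mod_cast this)
  have h2 : ∑ v ∈ {v | x a ≤ x v}, G.laplacian.mulVec x v ≤ (∑ v, f v : ℕ) := by
    push_cast
    refine le_trans (sum_le_sum (g := fun v => (f v : ℤ)) fun v _ => ?_)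
      (sum_le_univ_sum_of_nonneg fun v => by positivity)
    have := hx v
    have := hE v
    omega
  omega

theorem le_add_mul_card (hG : G.Connected) {E x : V → ℤ} {f : V → ℕ} (hE : IsEffective E)
    (hx : ∀ v, E v = f v - G.laplacian.mulVec x v) (v w : V) :
    x v ≤ x w + ((∑ v, f v) * Fintype.card V : ℕ) := by
  have hwalk : ∀ {a b : V} (p : G.toSimpleGraph.Walk a b),
      x a ≤ x b + ((∑ v, f v) * p.length : ℕ) := by
    intro a b p
    induction p with
    | nil => simp
    | cons h p ih =>
      have := G.sub_le_of_adj hE hx h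
      rw [SimpleGraph.Walk.length_cons, mul_add, mul_one]
      push_cast at *
      omega
  obtain ⟨p, hp⟩ := (hG.preconnected v w).exists_isPath
  refine (hwalk p).trans ?_
  have := hp.length_lt
  gcongr

end Multigraph

/-! ### Elimination orders -/

namespace Multigraph

variable {V : Type*} [DecidableEq V] [Fintype V] (G : Multigraph V)

/-- `w` gets its first chip in round `t` of the firing towards `w`. -/
def IsHit (D : V → ℕ) (w : V) (t : ℕ) : Prop :=
  0 < G.chipSeq D w t w ∧ ∀ i < t, G.chipSeq D w i w = 0

/-- Thresholds that keep a fire from `v` away from the vertices with smaller key than `v`. -/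
def wall (key : V → ℕ) (v u : V) : ℕ := if key u < key v then G.edges.card else 0

/-- The component of `v` in the graph on the vertices whose keys are not smaller. -/
def lowerComp (key : V → ℕ) (v : V) : Finset V := G.burnSet (G.wall key v) v

/-- The neighbours of `lowerComp`. -/
def boundary (key : V → ℕ) (v : V) : Finset V :=
  univ.filter fun u => u ∉ G.lowerComp key v ∧ 0 < G.edgesTo (G.lowerComp key v) u

/-- The bag of `v` in the tree decomposition of an elimination order. -/
def elimBag (key : V → ℕ) (v : V) : Finset V := insert v (G.boundary key v)

open Classical in
/-- The parent of `v` in the tree of an elimination order. -/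
noncomputable def elimParent (key : V → ℕ) (v : V) : V :=
  if h : (G.boundary key v).Nonempty then ((G.boundary key v).exists_max_image key h).choose else v

/-- The tree of an elimination order. -/
def elimTree (key : V → ℕ) : SimpleGraph V :=
  SimpleGraph.fromEdgeSet {e | ∃ v, (G.boundary key v).Nonempty ∧ e = s(v, G.elimParent key v)}

variable {G} {key : V → ℕ}

theorem mem_lowerComp_self (v : V) : v ∈ G.lowerComp key v := G.mem_burnSet_self _ _

/-- No vertex has more than `edges.card` edges, while one edge exceeds the threshold `0`. So the
fire spreads exactly along vertices whose keys are large enough, and burning doubles as a component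
search. -/
theorem lowerComp_induction {v : V} {P : V → Prop} (hv : P v)
    (h : ∀ a b, P a → G.toSimpleGraph.Adj a b → key v ≤ key b → P b) :
    ∀ u ∈ G.lowerComp key v, P u := by
  refine burnSet_induction hv fun S u hS hlt => ?_
  unfold wall at hlt
  split_ifs at hlt with hk
  · exact absurd ((G.edgesTo_le S u).trans (G.vertexDegree_le u)) (not_le.2 hlt)
  · obtain ⟨a, ha, hau⟩ := G.edgesTo_pos_iff.1 hlt
    exact h a u (hS a ha) hau (not_lt.1 hk)

theorem key_le_of_mem_lowerComp {u v : V} (h : u ∈ G.lowerComp key v) : key v ≤ key u :=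
  lowerComp_induction (P := fun u => key v ≤ key u) le_rfl (fun _ _ _ _ h => h) u h

theorem mem_lowerComp_of_adj {a b v : V} (ha : a ∈ G.lowerComp key v)
    (h : G.toSimpleGraph.Adj a b) (hb : key v ≤ key b) : b ∈ G.lowerComp key v :=
  mem_burnSet_of_adj ha h (by simp [wall, not_lt.2 hb])

theorem mem_boundary_iff {u v : V} : u ∈ G.boundary key v ↔
    u ∉ G.lowerComp key v ∧ ∃ a ∈ G.lowerComp key v, G.toSimpleGraph.Adj a u := by
  simp [boundary, edgesTo_pos_iff]

theorem key_lt_of_mem_boundary {u v : V} (h : u ∈ G.boundary key v) : key u < key v := by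
  obtain ⟨hu, a, ha, hau⟩ := mem_boundary_iff.1 h
  by_contra! hk
  exact hu (mem_lowerComp_of_adj ha hau hk)

theorem elimParent_mem {v : V} (h : (G.boundary key v).Nonempty) :
    G.elimParent key v ∈ G.boundary key v := by
  rw [elimParent, dif_pos h]
  exact ((G.boundary key v).exists_max_image key h).choose_spec.1

theorem key_le_elimParent {u v : V} (h : u ∈ G.boundary key v) :
    key u ≤ key (G.elimParent key v) := by
  rw [elimParent, dif_pos ⟨u, h⟩]
  exact ((G.boundary key v).exists_max_image key ⟨u, h⟩).choose_spec.2 u h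

theorem elimParent_eq (hk : Function.Injective key) {v p : V} (hp : p ∈ G.boundary key v)
    (h : ∀ u ∈ G.boundary key v, key u ≤ key p) : G.elimParent key v = p :=
  hk ((h _ (elimParent_mem ⟨p, hp⟩)).antisymm (key_le_elimParent hp))

theorem elimTree_adj_elimParent {v : V} (h : (G.boundary key v).Nonempty) :
    (G.elimTree key).Adj v (G.elimParent key v) := by
  rw [elimTree, SimpleGraph.fromEdgeSet_adj]
  refine ⟨⟨v, h, rfl⟩, fun he => ?_⟩
  have := key_lt_of_mem_boundary (elimParent_mem h)
  rw [← he] at this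
  exact lt_irrefl _ this

theorem key_le_of_boundary_eq_empty (hG : G.Connected) {v : V} (h : ¬ (G.boundary key v).Nonempty)
    (u : V) : key v ≤ key u := by
  refine key_le_of_mem_lowerComp (G := G) ?_
  obtain ⟨p⟩ := hG.preconnected v u
  suffices ∀ {a b : V}, G.toSimpleGraph.Walk a b → a ∈ G.lowerComp key v →
      b ∈ G.lowerComp key v from this p (mem_lowerComp_self v)
  intro a b p
  induction p with
  | nil => exact id
  | cons hab p ih =>
    refine fun ha => ih ?_
    by_contra hb
    exact h ⟨_, mem_boundary_iff.2 ⟨hb, _, ha, hab⟩⟩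

/-- There is exactly one vertex without a parent. -/
theorem exists_root (hk : Function.Injective key) (hG : G.Connected) :
    ∃ r, ∀ v, (G.boundary key v).Nonempty ↔ v ≠ r := by
  have := hG.nonempty
  obtain ⟨r, -, hr⟩ := univ.exists_min_image key univ_nonempty
  refine ⟨r, fun v => ⟨?_, fun hv => ?_⟩⟩
  · rintro ⟨u, hu⟩ rfl
    exact absurd (hr u (mem_univ u)) (not_le.2 (key_lt_of_mem_boundary hu))
  · by_contra h
    exact hv (hk ((key_le_of_boundary_eq_empty hG h r).antisymm (hr v (mem_univ v))))

/-- Parents have smaller keys, so every vertex climbs to the root. There is at most one edge for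
each other vertex, and a connected graph with so few edges is a tree. -/
theorem elimTree_isTree (hk : Function.Injective key) (hG : G.Connected) :
    (G.elimTree key).IsTree := by
  have := hG.nonempty
  obtain ⟨r, hr⟩ := exists_root hk hG
  have hreach : ∀ N v, key v ≤ N → (G.elimTree key).Reachable v r := by
    intro N
    induction N using Nat.strong_induction_on with
    | _ N ih =>
      intro v hv
      by_cases hvr : v = r
      · rw [hvr]
      · have hne := (hr v).2 hvr
        have hlt := key_lt_of_mem_boundary (elimParent_mem hne)
        exact (elimTree_adj_elimParent hne).reachable.trans (ih _ (hlt.trans_le hv) _ le_rfl)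
  have hconn : (G.elimTree key).Connected :=
    ⟨fun u v => (hreach _ u le_rfl).trans (hreach _ v le_rfl).symm⟩
  rw [SimpleGraph.isTree_iff_connected_and_card, Nat.card_coe_set_eq]
  refine ⟨hconn, le_antisymm ?_ hconn.card_vert_le_card_edgeSet_add_one⟩
  have hsub : (G.elimTree key).edgeSet ⊆
      ((univ.erase r).image fun v => s(v, G.elimParent key v) : Finset (Sym2 V)) := by
    rw [elimTree, SimpleGraph.edgeSet_fromEdgeSet]
    rintro e ⟨⟨v, hv, rfl⟩, -⟩
    simpa using ⟨v, (hr v).1 hv, Or.inl ⟨rfl, rfl⟩⟩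
  have hcard := Set.ncard_le_ncard hsub (finite_toSet _)
  rw [Set.ncard_coe_finset] at hcard
  have := hcard.trans card_image_le
  rw [card_erase_of_mem (mem_univ r), card_univ] at this
  rw [Nat.card_eq_fintype_card]
  have hpos := Fintype.card_pos (α := V)
  omega

/-- The component of `i` has its parent as a neighbour, hence is absorbed in the parent's component.
Any other neighbour `v` remains outside, its key being smaller than the parent's. So the nodes with
`v` in their bag lead up to `v` along parents. -/
theorem mem_elimBag_elimParent (hk : Function.Injective key) {v i : V} (h : v ∈ G.boundary key i) :
    v ∈ G.elimBag key (G.elimParent key i) := by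
  have hp := elimParent_mem ⟨v, h⟩
  obtain ⟨-, a, ha, hap⟩ := mem_boundary_iff.1 hp
  rw [elimBag, mem_insert]
  by_cases hv : v = G.elimParent key i
  · exact Or.inl hv
  right
  have hlt := key_lt_of_mem_boundary hp
  -- The component of `i` lies wholly inside or wholly outside that of the parent.
  have hiff : ∀ u ∈ G.lowerComp key i, key i ≤ key u ∧
      (u ∈ G.lowerComp key (G.elimParent key i) ↔ i ∈ G.lowerComp key (G.elimParent key i)) := by
    refine lowerComp_induction ⟨le_rfl, Iff.rfl⟩ fun b c hb hbc hc => ⟨hc, Iff.trans ?_ hb.2⟩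
    exact ⟨fun h => mem_lowerComp_of_adj h hbc.symm (hlt.le.trans hb.1),
      fun h => mem_lowerComp_of_adj h hbc (hlt.le.trans hc)⟩
  have ha' : a ∈ G.lowerComp key (G.elimParent key i) :=
    mem_lowerComp_of_adj (mem_lowerComp_self _) hap.symm (hlt.le.trans (hiff a ha).1)
  obtain ⟨-, b, hb, hbv⟩ := mem_boundary_iff.1 h
  refine mem_boundary_iff.2 ⟨fun hmem => ?_, b,
    (hiff b hb).2.2 ((hiff a ha).2.1 ha'), hbv⟩
  exact hv (hk ((key_le_elimParent h).antisymm (key_le_of_mem_lowerComp hmem)))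

/-- An elimination order gives a tree decomposition. -/
theorem elimTree_isTreeDecomposition (hk : Function.Injective key) (hG : G.Connected) :
    IsTreeDecomposition G (G.elimTree key) (G.elimBag key) where
  isTree := elimTree_isTree hk hG
  exists_mem_bag v := ⟨v, mem_insert_self _ _⟩
  exists_edge_bag := by
    have h : ∀ u v, s(u, v) ∈ G.edges → key u < key v →
        u ∈ G.elimBag key v ∧ v ∈ G.elimBag key v := fun u v he hlt =>
      ⟨mem_insert_of_mem (mem_boundary_iff.2
        ⟨fun hu => absurd (key_le_of_mem_lowerComp hu) (not_le.2 hlt), v, mem_lowerComp_self v,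
          SimpleGraph.Adj.symm (G := G.toSimpleGraph) he⟩), mem_insert_self _ _⟩
    intro u v he
    rcases lt_trichotomy (key u) (key v) with hlt | heq | hlt
    · exact ⟨v, h u v he hlt⟩
    · exact absurd (Sym2.mk_isDiag_iff.2 (hk heq)) (G.loopless _ he)
    · exact ⟨u, (h v u (by rwa [Sym2.eq_swap]) hlt).symm⟩
  connected_nodes v := by
    have hv : v ∈ {i | v ∈ G.elimBag key i} := mem_insert_self _ _
    have hreach : ∀ N i (hi : i ∈ {i | v ∈ G.elimBag key i}), key i ≤ N →
        ((G.elimTree key).induce {i | v ∈ G.elimBag key i}).Reachable ⟨i, hi⟩ ⟨v, hv⟩ := by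
      intro N
      induction N using Nat.strong_induction_on with
      | _ N ih =>
        intro i hi hN
        rcases mem_insert.1 hi with rfl | hb
        · rfl
        · have hlt := key_lt_of_mem_boundary (elimParent_mem ⟨v, hb⟩)
          refine SimpleGraph.Reachable.trans (SimpleGraph.Adj.reachable ?_)
            (ih _ (hlt.trans_le hN) (G.elimParent key i) (mem_elimBag_elimParent hk hb) le_rfl)
          exact elimTree_adj_elimParent (G := G) ⟨v, hb⟩
    have : Nonempty {i | v ∈ G.elimBag key i} := ⟨⟨v, hv⟩⟩
    exact ⟨fun a b => (hreach _ a.1 a.2 le_rfl).trans (hreach _ b.1 b.2 le_rfl).symm⟩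

end Multigraph

/-! ### The width of the decomposition -/

namespace Multigraph

variable {V : Type*} [DecidableEq V] [Fintype V] {G : Multigraph V} {D : V → ℕ} {τ : V → ℕ}

/-- Adjacent vertices that are both not hit before round `j` have the same chips until then. -/
theorem chipSeq_eq_of_adj (hτ : ∀ v, G.IsHit D v (τ v)) {a b : V} (h : G.toSimpleGraph.Adj a b)
    {j : ℕ} (ha : j ≤ τ a) (hb : j ≤ τ b) : G.chipSeq D a j = G.chipSeq D b j := by
  induction j with
  | zero => rfl
  | succ j ih =>
    have hj := ih (by omega) (by omega)
    have hB := burnSet_eq_of_adj (f := G.chipSeq D a j) h ((hτ a).2 j ha)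
      (hj ▸ (hτ b).2 j hb)
    rw [chipSeq_succ, chipSeq_succ, ← hj]
    funext v
    simp only [fire, hB]

/-- A vertex that is hit before its neighbour `a` keeps a chip until `a` is hit. -/
theorem chipSeq_pos_of_adj (hτ : ∀ v, G.IsHit D v (τ v)) {a b : V} (h : G.toSimpleGraph.Adj a b)
    {i : ℕ} (hb : τ b ≤ i) (ha : i < τ a) : 0 < G.chipSeq D a i b := by
  induction i, hb using Nat.le_induction with
  | base => rw [chipSeq_eq_of_adj hτ h ha.le le_rfl]; exact (hτ b).1
  | succ i hi ih =>
    have hpos := ih (by omega)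
    have hza := (hτ a).2 (i + 1) ha
    rw [chipSeq_succ, fire_of_mem _ (G.mem_burnSet_self _ a)] at hza
    rw [chipSeq_succ]
    by_cases hmem : b ∈ G.burnSet (G.chipSeq D a i) a
    · rw [fire_of_mem _ hmem]; omega
    -- If `b` fired, its neighbour `a` would receive a chip before the round in which it is hit.
    · have : 0 < G.edgesTo (G.burnSet (G.chipSeq D a i) a)ᶜ a :=
        G.edgesTo_pos_iff.2 ⟨b, by simpa using hmem, h.symm⟩
      omega

variable {key : V → ℕ}

theorem card_boundary_le (hτ : ∀ v, G.IsHit D v (τ v))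
    (hkey : ∀ u v, key u ≤ key v → τ u ≤ τ v) (v : V) : #(G.boundary key v) ≤ ∑ u, D u := by
  rcases Nat.eq_zero_or_pos (τ v) with h0 | hpos
  -- Boundary vertices come before `v`, so here they all carry a chip of `D` itself.
  · rw [card_eq_sum_ones]
    refine (sum_le_sum (g := D) fun u hu => ?_).trans
      (sum_le_sum_of_subset (subset_univ _))
    have := hkey u v (key_lt_of_mem_boundary hu).le
    have h := (hτ u).1
    rwa [show τ u = 0 by omega] at h
  obtain ⟨i, hi⟩ := Nat.exists_eq_add_of_lt hpos
  rw [zero_add] at hi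
  rw [← G.sum_chipSeq D v i]
  set f := G.chipSeq D v i with hf
  set B := G.burnSet f v with hB
  set C := G.lowerComp key v with hC
  -- The whole component plays the game of `v` up to round `i + 1` and burns in round `i`.
  have hCp : ∀ a ∈ C, (i + 1 ≤ τ a ∧ ∀ j ≤ i + 1, G.chipSeq D a j = G.chipSeq D v j) ∧ a ∈ B := by
    refine lowerComp_induction ⟨⟨hi.ge, fun _ _ => rfl⟩, G.mem_burnSet_self f v⟩
      fun a b ha hab hb => ?_
    have hb' : i + 1 ≤ τ b := hi ▸ hkey _ _ hb
    have heq : ∀ j ≤ i + 1, G.chipSeq D b j = G.chipSeq D v j := fun j hj => by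
      rw [← ha.1.2 j hj, chipSeq_eq_of_adj hτ hab (hj.trans ha.1.1) (hj.trans hb')]
    refine ⟨⟨hb', heq⟩, mem_burnSet_of_adj ha.2 hab ?_⟩
    rw [hf, ← heq i (by omega)]
    exact (hτ b).2 i (by omega)
  have hCB : C ⊆ B := fun a ha => (hCp a ha).2
  -- Hit together with `v`: the first chip has just come across the rim of the fire. Hit earlier: a
  -- chip is still there.
  have htype : ∀ u ∈ G.boundary key v,
      (τ u = i + 1 ∧ u ∈ B ∧ u ∉ C ∧ 1 ≤ G.edgesTo Bᶜ u) ∨ 1 ≤ f u := by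
    intro u hu
    obtain ⟨huC, a, ha, hau⟩ := mem_boundary_iff.1 hu
    have hle := hkey u v (key_lt_of_mem_boundary hu).le
    obtain ⟨⟨ha1, ha2⟩, ha3⟩ := hCp a ha
    rcases eq_or_lt_of_le hle with heq | hlt
    · left
      have h1 : ∀ j ≤ i + 1, G.chipSeq D u j = G.chipSeq D v j := fun j hj => by
        rw [← ha2 j hj, chipSeq_eq_of_adj hτ hau (hj.trans ha1) (by omega)]
      have hfu : f u = 0 := by rw [hf, ← h1 i (by omega)]; exact (hτ u).2 i (by omega)
      have huB : u ∈ B := mem_burnSet_of_adj ha3 hau hfu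
      refine ⟨by omega, huB, huC, ?_⟩
      have := (hτ u).1
      rw [heq, hi, h1 _ le_rfl, chipSeq_succ, ← hf, fire_of_mem _ huB, hfu, ← hB] at this
      omega
    · right
      rw [hf, ← ha2 i (by omega)]
      exact chipSeq_pos_of_adj hτ hau (by omega) (by omega)
  set F := (G.boundary key v).filter fun u => τ u = i + 1 ∧ u ∈ B ∧ u ∉ C ∧ 1 ≤ G.edgesTo Bᶜ u
    with hF
  have hFB : F ∪ C ⊆ B := union_subset (fun u hu => (mem_filter.1 hu).2.2.1) hCB
  have hdisj : Disjoint F C := disjoint_left.2 fun u hu => (mem_filter.1 hu).2.2.2.1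
  set N := (G.boundary key v) \ F with hN
  have hcard : #(G.boundary key v) = #F + #N := by
    rw [hN, add_comm]
    exact (card_sdiff_add_card_eq_card (filter_subset _ _)).symm
  have hNsub : #N = #(N ∩ B) + #(N \ B) := (card_inter_add_card_sdiff N B).symm
  have hNB : #(N ∩ B) ≤ ∑ u ∈ B, f u := by
    rw [card_eq_sum_ones]
    refine (sum_le_sum (g := f) fun u hu => ?_).trans (sum_le_sum_of_subset inter_subset_right)
    obtain ⟨huN, -⟩ := mem_inter.1 hu
    obtain ⟨hub, hnF⟩ := mem_sdiff.1 huN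
    exact (htype u hub).resolve_left fun h => hnF (mem_filter.2 ⟨hub, h⟩)
  -- Chips outside `B` cover all edges into `B`. Each vertex of `F` sends such an edge out, each
  -- vertex of `N \ B` has one to `C`, and `F` and `C` are disjoint.
  have hout : #F + #(N \ B) ≤ ∑ u ∈ Bᶜ, f u := by
    have h1 : ∑ u ∈ Bᶜ, (G.edgesTo F u + G.edgesTo C u) ≤ ∑ u ∈ Bᶜ, f u := by
      refine sum_le_sum fun u hu => ?_
      rw [edgesTo, edgesTo, ← sum_union hdisj]
      exact (G.edgesTo_mono hFB u).trans (edgesTo_burnSet_le (by simpa using hu))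
    have h2 : #F ≤ ∑ u ∈ Bᶜ, G.edgesTo F u := by
      have : ∑ u ∈ Bᶜ, G.edgesTo F u = ∑ u ∈ F, G.edgesTo Bᶜ u := by
        simp only [edgesTo]
        rw [sum_comm]
        simp only [G.mult_comm]
      rw [this, card_eq_sum_ones]
      exact sum_le_sum fun u hu => (mem_filter.1 hu).2.2.2.2
    have h3 : #(N \ B) ≤ ∑ u ∈ Bᶜ, G.edgesTo C u := by
      rw [card_eq_sum_ones]
      refine (sum_le_sum (g := fun u => G.edgesTo C u) fun u hu => ?_).trans
        (sum_le_sum_of_subset fun u hu => by simpa using (mem_sdiff.1 hu).2)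
      obtain ⟨-, a, ha, hau⟩ := mem_boundary_iff.1 (mem_sdiff.1 (mem_sdiff.1 hu).1).1
      exact G.edgesTo_pos_iff.2 ⟨a, ha, hau⟩
    rw [sum_add_distrib] at h1
    omega
  rw [← sum_add_sum_compl B f]
  omega

/-! ### Cutting off the rounds; the key -/

variable (G) in
/-- The number of rounds of firing towards `w`, among the first `q`, if one stops as soon as there
is a chip on `w`. -/
def rounds (D : V → ℕ) (w : V) : ℕ → ℕ
  | 0 => 0
  | q + 1 => if G.chipSeq D w (rounds D w q) w = 0 then rounds D w q + 1 else rounds D w q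

theorem rounds_eq_min {w : V} {t : ℕ} (h : G.IsHit D w t) (q : ℕ) :
    G.rounds D w q = min q t := by
  induction q with
  | zero => simp [rounds]
  | succ q ih =>
    rw [rounds, ih]
    rcases lt_or_ge q t with hq | hq
    · rw [min_eq_left hq.le, if_pos (h.2 q hq), min_eq_left hq]
    · rw [min_eq_right hq, if_neg h.1.ne', min_eq_right (by omega)]

/-- Every vertex has a chip on some effective divisor equivalent to `D`. -/
def ReachesAll (G : Multigraph V) (D : V → ℤ) : Prop :=
  ∀ w, ∃ E, G.DivisorEquiv D E ∧ IsEffective E ∧ 0 < E w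

theorem exists_isHit (hG : G.Connected) (hD : G.ReachesAll fun v => (D v : ℤ)) (w : V) :
    ∃ t ≤ (∑ v, D v) * Fintype.card V, G.IsHit D w t := by
  obtain ⟨E, ⟨x, hx⟩, hE, hw⟩ := hD w
  have hx' : ∀ v, E v = D v - G.laplacian.mulVec x v := fun v => congrFun hx v
  have hex : ∃ i ≤ (∑ v, D v) * Fintype.card V, 0 < G.chipSeq D w i w :=
    G.exists_chipSeq_pos hE hw _ D x hx' fun v => G.le_add_mul_card hG hE hx' v w
  classical
  obtain ⟨i, hi, hpos⟩ := hex
  have hex : ∃ i, 0 < G.chipSeq D w i w := ⟨i, hpos⟩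
  exact ⟨Nat.find hex, (Nat.find_min' hex hpos).trans hi, Nat.find_spec hex,
    fun j hj => Nat.eq_zero_of_not_pos (Nat.find_min hex hj)⟩

/-- The key of the elimination order: the vertices are sorted by the round in which they are
hit. -/
def chipKey (G : Multigraph V) (D : V → ℕ) (e : V → ℕ) (w : V) : ℕ :=
  e w + Fintype.card V * G.rounds D w (Fintype.card V * Fintype.card V)

variable {e : V → ℕ}

/-- The tie-breaker is the residue of the key modulo `card V`, so keys differ even if the cutoff
precedes a hit. -/
theorem chipKey_injective (he : Function.Injective e) (hlt : ∀ v, e v < Fintype.card V) :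
    Function.Injective (G.chipKey D e) := by
  intro u v h
  apply he
  have := congrArg (· % Fintype.card V) h
  simpa [chipKey, Nat.mod_eq_of_lt (hlt _)] using this

/-- A degree of at least `card V` makes the bound trivial. Below that, every hit occurs before the
cutoff, so the key sorts by hitting times. -/
theorem card_elimBag_chipKey_le (hG : G.Connected) (hlt : ∀ v, e v < Fintype.card V)
    (hD : G.ReachesAll fun v => (D v : ℤ)) (v : V) :
    #(G.elimBag (G.chipKey D e) v) ≤ ∑ u, D u + 1 := by
  rcases le_or_gt (Fintype.card V) (∑ u, D u) with hle | hgt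
  · have := card_le_univ (G.elimBag (G.chipKey D e) v)
    omega
  refine (card_insert_le _ _).trans (Nat.add_le_add_right ?_ 1)
  choose τ hτ hhit using exists_isHit hG hD
  refine card_boundary_le hhit (fun u w h => ?_) v
  by_contra! hlt'
  have hr : ∀ z, G.rounds D z (Fintype.card V * Fintype.card V) = τ z := fun z => by
    rw [rounds_eq_min (hhit z), min_eq_right ((hτ z).trans (by gcongr))]
  simp only [chipKey, hr] at h
  have h1 := hlt w
  have h2 : Fintype.card V * (τ w + 1) ≤ Fintype.card V * τ u := by gcongr; omega
  rw [mul_add] at h2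
  omega

/-! ### Rank and gonality -/

theorem divisorDegree_eq_of_equiv {D E : V → ℤ} (h : G.DivisorEquiv D E) :
    divisorDegree E = divisorDegree D := by
  obtain ⟨x, rfl⟩ := h
  simp [divisorDegree, sum_univ_laplacian_mulVec]

omit [DecidableEq V] in
theorem IsEffective.degree_nonneg {D : V → ℤ} (h : IsEffective D) : 0 ≤ divisorDegree D :=
  sum_nonneg fun v _ => h v

theorem equivEffective_of_rank_pos {D : V → ℤ} (h : 1 ≤ G.rank D) : G.EquivEffective D := by
  by_contra hn
  rw [rank, if_neg hn] at h
  omega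

/-- Test the rank with one chip on `w` and add that chip back. -/
theorem reachesAll_of_rank_pos {D : V → ℤ} (h : 1 ≤ G.rank D) : G.ReachesAll D := by
  rw [rank, if_pos (equivEffective_of_rank_pos h)] at h
  have h1 : 1 ≤ sSup {k : ℕ | ∀ E : V → ℤ, IsEffective E → divisorDegree E ≤ k →
      G.EquivEffective (D - E)} := by exact_mod_cast h
  obtain ⟨k, hk, hk1⟩ : ∃ k ∈ {k : ℕ | ∀ E : V → ℤ, IsEffective E → divisorDegree E ≤ k →
      G.EquivEffective (D - E)}, 1 ≤ k := by
    by_contra! hcon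
    have hle : sSup {k : ℕ | ∀ E : V → ℤ, IsEffective E → divisorDegree E ≤ k →
      G.EquivEffective (D - E)} ≤ 0 := csSup_le' fun k hk => by have := hcon k hk; omega
    omega
  intro w
  obtain ⟨E, ⟨x, hx⟩, hE⟩ := hk (Pi.single w 1)
    (fun v => by by_cases hv : v = w <;> simp [hv])
    (by simp [divisorDegree]; exact hk1)
  refine ⟨E + Pi.single w 1, ⟨x, by rw [hx]; abel⟩, fun v => ?_, ?_⟩
  · have := hE v
    by_cases hv : v = w <;> simp [hv]
    · subst hv; omega
    · exact this
  · have := hE w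
    simp; omega

/-- One chip on every vertex suffices; this makes the set behind `dgon` nonempty. -/
theorem exists_rank_pos [Nonempty V] (G : Multigraph V) : ∃ D : V → ℤ, 1 ≤ G.rank D := by
  have hself : ∀ D : V → ℤ, IsEffective D → G.EquivEffective D := fun D hD =>
    ⟨D, ⟨0, by simp⟩, hD⟩
  refine ⟨1, ?_⟩
  rw [rank, if_pos (hself 1 fun v => by simp)]
  have : 1 ≤ sSup {k : ℕ | ∀ E : V → ℤ, IsEffective E → divisorDegree E ≤ k →
      G.EquivEffective (1 - E)} := by
    -- On an unbounded set `sSup` would be `0`; testing with `k` chips on one vertex bounds `k` by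
    -- the degree.
    refine le_csSup ⟨Fintype.card V, fun k hk => ?_⟩ fun E hE hdeg => hself _ fun v => ?_
    · obtain ⟨v⟩ := ‹Nonempty V›
      obtain ⟨E, hE, heff⟩ := hk (Pi.single v k)
        (fun u => by by_cases hu : u = v <;> simp [hu]) (by simp [divisorDegree])
      have h0 := IsEffective.degree_nonneg heff
      rw [divisorDegree_eq_of_equiv hE] at h0
      simp [divisorDegree] at h0
      exact h0
    · have : E v ≤ divisorDegree E := single_le_sum (fun u _ => hE u) (mem_univ v)
      simp only [Pi.sub_apply, Pi.one_apply]
      push_cast at hdeg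
      omega
  exact_mod_cast this

theorem ReachesAll.of_equiv {D D' : V → ℤ} (h : G.ReachesAll D) (hD : G.DivisorEquiv D D') :
    G.ReachesAll D' := by
  obtain ⟨x, rfl⟩ := hD
  intro w
  obtain ⟨E, ⟨z, rfl⟩, hE⟩ := h w
  exact ⟨_, ⟨z - x, by rw [Matrix.mulVec_sub]; abel⟩, hE⟩

end Multigraph

/-! ### From bags to treewidth -/

theorem bagWidth_le {V I : Type*} [Fintype I] {X : I → Finset V} {k : ℕ}
    (h : ∀ i, #(X i) ≤ k + 1) : bagWidth X ≤ k := by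
  have : (univ.sup fun i => #(X i)) ≤ k + 1 := Finset.sup_le fun i _ => h i
  unfold bagWidth
  omega

/-- A tree decomposition can be transported along a bijection of the nodes. -/
theorem IsTreeDecomposition.comap {V I J : Type*} {G : Multigraph V} {T : SimpleGraph I}
    {X : I → Finset V} (h : IsTreeDecomposition G T X) (e : J ≃ I) :
    IsTreeDecomposition G (T.comap e) (X ∘ e) where
  isTree := (SimpleGraph.Iso.comap e T).isTree_iff.2 h.isTree
  exists_mem_bag v := by
    obtain ⟨i, hi⟩ := h.exists_mem_bag v
    exact ⟨e.symm i, by simpa⟩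
  exists_edge_bag u v huv := by
    obtain ⟨i, hi⟩ := h.exists_edge_bag u v huv
    exact ⟨e.symm i, by simpa⟩
  connected_nodes v := by
    let f : (T.comap e).induce {i | v ∈ (X ∘ e) i} ≃g T.induce {i | v ∈ X i} :=
      { toEquiv := e.subtypeEquiv fun _ => Iff.rfl
        map_rel_iff' := Iff.rfl }
    exact f.connected_iff.2 (h.connected_nodes v)

/-- An optimal divisor may have negative entries; an equivalent effective one has the same degree
and reaches the same vertices. -/
theorem Multigraph.treewidth_le_dgon {V : Type*} [Fintype V] [DecidableEq V] (G : Multigraph V)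
    (hG : G.Connected) : G.treewidth ≤ G.dgon := by
  have := hG.nonempty
  obtain ⟨D, hrank, hdeg⟩ : G.dgon ∈ {k : ℤ | ∃ D : V → ℤ, 1 ≤ G.rank D ∧ divisorDegree D = k} := by
    refine Int.csInf_mem ?_ ⟨0, ?_⟩
    · obtain ⟨D, hD⟩ := G.exists_rank_pos
      exact ⟨_, D, hD, rfl⟩
    · rintro _ ⟨D, hD, rfl⟩
      obtain ⟨E, hE, heff⟩ := equivEffective_of_rank_pos hD
      rw [← divisorDegree_eq_of_equiv hE]
      exact IsEffective.degree_nonneg heff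
  obtain ⟨E, hE, heff⟩ := equivEffective_of_rank_pos hrank
  lift E to V → ℕ using heff
  have hreach := (reachesAll_of_rank_pos hrank).of_equiv hE
  have hdegE : ((∑ v, E v : ℕ) : ℤ) = G.dgon := by
    rw [← hdeg, ← divisorDegree_eq_of_equiv hE]
    simp [divisorDegree]
  let e := Fintype.equivFin V
  have hdec := (elimTree_isTreeDecomposition (G := G) (key := G.chipKey E fun v => (e v : ℕ))
    (chipKey_injective (fun u v h => e.injective (Fin.ext h)) fun v => (e v).2) hG).comap e.symm
  rw [← hdegE]
  -- The bound `-1` is the width when all bags are empty.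
  refine le_trans (csInf_le ⟨-1, ?_⟩ ⟨_, _, _, hdec, rfl⟩)
    (bagWidth_le fun i => card_elimBag_chipKey_le hG (fun v => (e v).2) hreach _)
  rintro _ ⟨N, T, X, -, rfl⟩
  unfold bagWidth
  omega

/-! ### Building blocks of the program

Registers: `0` number of vertices, `1` number of edges, `2` number of rounds, `3`, `4`, `7`, `9`
loop counters, `5` accumulator, `6` current vertex, `8` key, `10` parent.
Arrays: `0` row offsets, `1` multiplicities, `2` degrees, `3` input divisor, `4` thresholds,
`5` marks of burnt vertices, `6` edges to burnt vertices, `7` keys. -/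

namespace RAM

namespace State

variable (s : State)

theorem reg_setReg (x c y : ℕ) : (s.setReg x c).reg y = if y = x then c else s.reg y := by
  simp [setReg, Function.update_apply]

theorem arr_setReg (x c : ℕ) : (s.setReg x c).arr = s.arr := rfl

theorem reg_setArr (a i c : ℕ) : (s.setArr a i c).reg = s.reg := rfl

theorem arr_setArr (a i c b k : ℕ) :
    (s.setArr a i c).arr b k = if b = a ∧ k = i then c else s.arr b k := by
  by_cases h : b = a
  · subst h; simp [setArr, Function.update_apply]
  · simp [setArr, h]

end State

open State RAM.Expr Program

/-- The sum of `g` over the first `k` indices. -/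
def partialSum {n : ℕ} (g : Fin n → ℕ) (k : ℕ) : ℕ := ∑ u ∈ univ.filter fun u => u.val < k, g u

theorem partialSum_zero {n : ℕ} (g : Fin n → ℕ) : partialSum g 0 = 0 := by simp [partialSum]

theorem partialSum_succ {n : ℕ} (g : Fin n → ℕ) {k : ℕ} (hk : k < n) :
    partialSum g (k + 1) = partialSum g k + g ⟨k, hk⟩ := by
  have : (univ.filter fun u : Fin n => u.val < k + 1) =
      insert ⟨k, hk⟩ (univ.filter fun u => u.val < k) := by
    ext u
    simp [Fin.ext_iff]
    omega
  rw [partialSum, this, sum_insert (by simp), add_comm, partialSum]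

theorem partialSum_self {n : ℕ} (g : Fin n → ℕ) : partialSum g n = ∑ u, g u := by
  simp [partialSum]

/-- The program leaves the representation of the graph intact. -/
def Program.keepsGraph (p : Program) : Bool :=
  !(p.modReg 0 || p.modReg 1 || p.modReg 2 || p.modArr 0 || p.modArr 1 || p.modArr 2)

/-- The state represents the graph `G`. -/
structure Represents {n : ℕ} (G : Multigraph (Fin n)) (s : State) : Prop where
  reg_zero : s.reg 0 = n
  reg_one : s.reg 1 = G.edges.card
  reg_two : s.reg 2 = n * n
  offset : ∀ u : Fin n, s.arr 0 u = n * u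
  mult : ∀ v u : Fin n, s.arr 1 (n * v + u) = G.mult v u
  deg : ∀ v : Fin n, s.arr 2 v = G.vertexDegree v

variable {n L : ℕ} {G : Multigraph (Fin n)} {s s' : State} {f : Fin n → ℕ}

theorem Represents.frame {p : Program} (h : Represents G s) (hF : Frame p s s')
    (hp : p.keepsGraph = true) : Represents G s' := by
  simp only [Program.keepsGraph, Bool.not_eq_true', Bool.or_eq_false_iff] at hp
  obtain ⟨⟨⟨⟨⟨r0, r1⟩, r2⟩, a0⟩, a1⟩, a2⟩ := hp
  exact ⟨(hF.reg _ r0).trans h.1, (hF.reg _ r1).trans h.2, (hF.reg _ r2).trans h.3,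
    fun u => by rw [hF.arr _ a0, h.offset], fun v u => by rw [hF.arr _ a1, h.mult],
    fun v => by rw [hF.arr _ a2, h.deg]⟩

theorem Represents.setReg (h : Represents G s) {x c : ℕ} (hx : 3 ≤ x) :
    Represents G (s.setReg x c) :=
  h.frame (Exec.assign x (.const c) s).frame (by
    simp [Program.keepsGraph, Program.modReg, Program.modArr]; omega)

/-- The nonzero entries of array `5` are at the elements of `S`. -/
def Marks (s : State) (S : Finset (Fin n)) : Prop := ∀ u : Fin n, s.arr 5 u ≠ 0 ↔ u ∈ S

/-- Count the edges from every vertex to the marked vertices. -/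
def countEdges : Program :=
  forLoop 3 0 (seq (assign 5 (const 0)) (seq
    (forLoop 4 0 (ite (get 5 (var 4))
      (assign 5 (add (var 5) (get 1 (add (get 0 (var 3)) (var 4))))) skip))
    (store 6 (var 3) (var 5))))

theorem wp_countEdges {S : Finset (Fin n)} (hL : n ≤ L) (hG : Represents G s) (hS : Marks s S) :
    WP L countEdges s fun s' => ∀ v : Fin n, s'.arr 6 v = G.edgesTo S v := by
  refine (WP.forLoop (fun j s' => ∀ v : Fin n, v.val < j → s'.arr 6 v = G.edgesTo S v) n hL
    hG.reg_zero (by decide) rfl rfl (fun _ _ _ h => h) (by simp) ?_).mono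
    fun s' _ h v => h v v.2
  intro j hj s₁ hF₁ h3 hI
  have hG₁ := hG.frame hF₁ rfl
  refine WP.seq (WP.assign (WP.seq ?_))
  refine (WP.forLoop (fun k s' => s'.reg 5 =
    partialSum (fun u => if u ∈ S then G.mult ⟨j, hj⟩ u else 0) k) n hL
    (by simpa [reg_setReg] using hG₁.reg_zero) (by decide) rfl rfl
    (fun k s c h => by simpa [reg_setReg] using h)
    (by simp [reg_setReg, Expr.eval, partialSum_zero]) ?_).mono ?_
  · intro k hk s₂ hF₂ h4 h5
    have hmark : s₂.arr 5 k ≠ 0 ↔ (⟨k, hk⟩ : Fin n) ∈ S := by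
      rw [hF₂.arr 5 rfl, arr_setReg, hF₁.arr 5 rfl]; exact hS ⟨k, hk⟩
    have hM : s₂.arr 1 (s₂.arr 0 j + k) = G.mult ⟨j, hj⟩ ⟨k, hk⟩ := by
      rw [hF₂.arr 1 rfl, hF₂.arr 0 rfl, arr_setReg, hG₁.offset ⟨j, hj⟩, ← hG₁.mult]
    have h3' : s₂.reg 3 = j := by rw [hF₂.reg 3 rfl]; simpa [reg_setReg] using h3
    rw [partialSum_succ _ hk]
    refine WP.ite (fun h => WP.assign ?_) (fun h => WP.skip ?_)
    · have := hmark.1 (by simpa [Expr.eval, h4] using h)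
      simp [reg_setReg, Expr.eval, h4, h3', h5, hM, this]
    · have := mt hmark.2 (by simpa [Expr.eval, h4] using h)
      simp [h5, this]
  · intro s₂ hF₂ h5
    refine WP.store fun v hv => ?_
    have h3' : s₂.reg 3 = j := by rw [hF₂.reg 3 rfl]; simpa [reg_setReg] using h3
    rw [arr_setArr]
    simp only [Expr.eval, h3', h5, partialSum_self, true_and]
    split_ifs with h
    · subst h
      simp [Multigraph.edgesTo]
    · rw [hF₂.arr 6 rfl]
      exact hI v (by omega)

/-- Mark all vertices that have more edges to marked vertices than their threshold. -/
def spread : Program :=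
  forLoop 3 0 (ite (sub (get 6 (var 3)) (get 4 (var 3))) (store 5 (var 3) (const 1)) skip)

/-- The counts in array `6` stay frozen while marks are added, so the burning is simultaneous, as in
`burnStep`. -/
theorem wp_spread {S : Finset (Fin n)} (hL : n ≤ L) (hG : Represents G s) (hS : Marks s S)
    (hf : ∀ v : Fin n, s.arr 4 v = f v) (hc : ∀ v : Fin n, s.arr 6 v = G.edgesTo S v) :
    WP L spread s fun s' => Marks s' (G.burnStep f S) := by
  refine (WP.forLoop (fun j s' => ∀ v : Fin n, s'.arr 5 v ≠ 0 ↔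
    v ∈ S ∨ (v.val < j ∧ f v < G.edgesTo S v)) n hL
    hG.reg_zero (by decide) rfl rfl (fun _ _ _ h => h) (fun v => by simpa using hS v) ?_).mono
    fun s' _ h v => by simp [h v, Multigraph.burnStep]
  intro j hj s₁ hF₁ h3 hI
  have h6 : s₁.arr 6 j = _ := (congrFun (hF₁.arr 6 rfl) _).trans (hc ⟨j, hj⟩)
  have h4 : s₁.arr 4 j = _ := (congrFun (hF₁.arr 4 rfl) _).trans (hf ⟨j, hj⟩)
  refine WP.ite (fun h => WP.store fun v => ?_) (fun h => WP.skip fun v => ?_)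
  · simp only [Expr.eval, h3, h6, h4] at h
    simp only [arr_setArr, Expr.eval, h3, true_and]
    by_cases hv : v.val = j
    · obtain rfl : v = ⟨j, hj⟩ := Fin.ext hv
      simp
      omega
    · rw [if_neg hv, hI v]
      have : v.val < j + 1 ↔ v.val < j := by omega
      rw [this]
  · simp only [Expr.eval, h3, h6, h4] at h
    rw [hI v]
    by_cases hv : v.val = j
    · obtain rfl : v = ⟨j, hj⟩ := Fin.ext hv
      simp
      omega
    · have : v.val < j + 1 ↔ v.val < j := by omega
      rw [this]

/-- Dhar's burning algorithm with the fire starting at the current vertex. -/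
def burn : Program :=
  seq (forLoop 3 0 (store 5 (var 3) (const 0))) (seq (store 5 (var 6) (const 1))
    (seq countEdges (forLoop 7 0 (seq spread countEdges))))

/-- The thresholds in array `4` are arbitrary, so one routine serves the game and the component
search. The final edge counts are kept because firing and boundaries need them. -/
theorem wp_burn {w : Fin n} (hL : n ≤ L) (hG : Represents G s) (hw : s.reg 6 = w)
    (hf : ∀ v : Fin n, s.arr 4 v = f v) :
    WP L burn s fun s' => Marks s' (G.burnSet f w) ∧
      ∀ v : Fin n, s'.arr 6 v = G.edgesTo (G.burnSet f w) v := by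
  refine WP.seq ((WP.forLoop (fun j s' => ∀ v : Fin n, v.val < j → s'.arr 5 v = 0) n hL
    hG.reg_zero (by decide) rfl rfl (fun _ _ _ h => h) (by simp) ?_).mono ?_)
  · intro j hj s₁ hF₁ h3 hI
    refine WP.store fun v hv => ?_
    simp only [arr_setArr, Expr.eval, h3, true_and]
    split_ifs with h
    · rfl
    · exact hI v (by omega)
  intro s₁ hF₁ h5
  have hG₁ := hG.frame hF₁ rfl
  refine WP.seq ((WP.store (Q := fun s' => Marks s' {w}) fun v => ?_).mono fun s₂ hF₂ h₂ => ?_)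
  · simp only [arr_setArr, Expr.eval, hF₁.reg 6 rfl, hw, true_and]
    by_cases h : v = w
    · simp [h]
    · rw [if_neg fun h' => h (Fin.ext h')]
      simp [h5 v v.2, h]
  have hG₂ := hG₁.frame hF₂ rfl
  refine WP.seq ((wp_countEdges hL hG₂ h₂).mono fun s₃ hF₃ h₃ => ?_)
  have hG₃ := hG₂.frame hF₃ rfl
  refine (WP.forLoop (fun j s' => Marks s' ((G.burnStep f)^[j] {w}) ∧
    ∀ v : Fin n, s'.arr 6 v = G.edgesTo ((G.burnStep f)^[j] {w}) v) n hL
    hG₃.reg_zero (by decide) rfl rfl (fun _ _ _ h => h) ⟨fun v => ?_, h₃⟩ ?_).mono ?_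
  · rw [hF₃.arr 5 rfl]; exact h₂ v
  · intro j hj s₄ hF₄ h7 hI
    have hG₄ := hG₃.frame hF₄ rfl
    rw [Function.iterate_succ_apply']
    refine WP.seq ((wp_spread (f := f) hL hG₄ hI.1 (fun v => ?_) hI.2).mono fun s₅ hF₅ h₅ => ?_)
    · rw [hF₄.arr 4 rfl, hF₃.arr 4 rfl, hF₂.arr 4 rfl, hF₁.arr 4 rfl, hf]
    refine (wp_countEdges hL (hG₄.frame hF₅ rfl) h₅).mono fun s₆ hF₆ h₆ => ⟨fun v => ?_, h₆⟩
    rw [hF₆.arr 5 rfl]; exact h₅ v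
  · intro s₄ _ h
    simpa only [Multigraph.burnSet, Fintype.card_fin] using h

end RAM

/-! ### The elimination order and its boundaries on the machine -/

namespace RAM

open State RAM.Expr Program

variable {n L : ℕ} {G : Multigraph (Fin n)} {s s' : State} {f : Fin n → ℕ}

/-- Fire all unmarked vertices. -/
def fireUnmarked : Program :=
  forLoop 3 0 (ite (get 5 (var 3))
    (store 4 (var 3) (sub (add (get 4 (var 3)) (get 2 (var 3))) (get 6 (var 3))))
    (store 4 (var 3) (sub (get 4 (var 3)) (get 6 (var 3)))))

theorem wp_fireUnmarked {w : Fin n} (hL : n ≤ L) (hG : Represents G s)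
    (hS : Marks s (G.burnSet f w)) (hf : ∀ v : Fin n, s.arr 4 v = f v)
    (hc : ∀ v : Fin n, s.arr 6 v = G.edgesTo (G.burnSet f w) v) :
    WP L fireUnmarked s fun s' => ∀ v : Fin n, s'.arr 4 v = G.fire w f v := by
  refine (WP.forLoop (fun j s' => ∀ v : Fin n, s'.arr 4 v =
    if v.val < j then G.fire w f v else f v) n hL
    hG.reg_zero (by decide) rfl rfl (fun _ _ _ h => h) (by simpa using hf) ?_).mono
    fun s' _ h v => by simp [h v]
  intro j hj s₁ hF₁ h3 hI
  have h4 := hI ⟨j, hj⟩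
  rw [if_neg (lt_irrefl j)] at h4
  have h6 : s₁.arr 6 j = _ := (congrFun (hF₁.arr 6 rfl) _).trans (hc ⟨j, hj⟩)
  have h2 : s₁.arr 2 j = _ := (hG.frame hF₁ rfl).deg ⟨j, hj⟩
  have h5 : s₁.arr 5 j ≠ 0 ↔ ⟨j, hj⟩ ∈ G.burnSet f w := by rw [hF₁.arr 5 rfl]; exact hS ⟨j, hj⟩
  have hupd : ∀ c, c = G.fire w f ⟨j, hj⟩ → ∀ v : Fin n, (s₁.setArr 4 j c).arr 4 v =
      if v.val < j + 1 then G.fire w f v else f v := by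
    rintro c rfl v
    simp only [arr_setArr, true_and]
    by_cases hv : v.val = j
    · obtain rfl : v = ⟨j, hj⟩ := Fin.ext hv
      simp
    · rw [if_neg hv, hI v]
      have : v.val < j + 1 ↔ v.val < j := by omega
      simp only [this]
  refine WP.ite (fun h => WP.store ?_) (fun h => WP.store ?_)
  · simp only [Expr.eval, h3] at h ⊢
    refine hupd _ ?_
    rw [Multigraph.fire, if_pos (h5.1 h), h4, h2, h6]
  · simp only [Expr.eval, h3] at h ⊢
    refine hupd _ ?_
    rw [Multigraph.fire, if_neg (mt h5.2 (not_not.2 h)), h4, h6]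

/-- Compute the key of the current vertex. -/
def computeKey : Program :=
  seq (forLoop 3 0 (store 4 (var 3) (get 3 (var 3)))) (seq (assign 8 (var 6)) (seq
    (forLoop 9 2 (ite (get 4 (var 6)) skip
      (seq (assign 8 (add (var 8) (var 0))) (seq burn fireUnmarked))))
    (store 7 (var 6) (var 8))))

/-- Each executed round adds `n` to the key, which replaces a multiplication; once `w` has a chip,
the loop idles. -/
theorem wp_computeKey {w : Fin n} {D : Fin n → ℕ} (hL : n ≤ L) (hL' : n * n ≤ L)
    (hG : Represents G s) (hw : s.reg 6 = w) (hD : ∀ v : Fin n, s.arr 3 v = D v) :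
    WP L computeKey s fun s' => s'.arr 7 w = G.chipKey D Fin.val w ∧
      ∀ v : ℕ, v ≠ w → s'.arr 7 v = s.arr 7 v := by
  refine WP.seq ((WP.forLoop (fun j s' => ∀ v : Fin n, v.val < j → s'.arr 4 v = D v) n hL
    hG.reg_zero (by decide) rfl rfl (fun _ _ _ h => h) (by simp) ?_).mono ?_)
  · intro j hj s₁ hF₁ h3 hI
    have hj3 : s₁.arr 3 j = D ⟨j, hj⟩ := by rw [hF₁.arr 3 rfl]; exact hD ⟨j, hj⟩
    refine WP.store fun v hv => ?_
    simp only [arr_setArr, Expr.eval, h3, true_and]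
    split_ifs with h
    · obtain rfl : v = ⟨j, hj⟩ := Fin.ext h
      exact hj3
    · exact hI v (by omega)
  intro s₁ hF₁ h4
  have hG₁ := (hG.frame hF₁ rfl).setReg (x := 8) (c := s₁.reg 6) (by norm_num)
  have hw₁ : s₁.reg 6 = w := by rw [hF₁.reg 6 rfl, hw]
  refine WP.seq (WP.assign (WP.seq ?_))
  refine (WP.forLoop (fun j s' => (∀ v : Fin n, s'.arr 4 v =
    G.chipSeq D w (G.rounds D w j) v) ∧ s'.reg 8 = w + n * G.rounds D w j) (n * n) hL'
    hG₁.reg_two (by decide) rfl rfl (fun _ _ _ h => by simpa [reg_setReg, arr_setReg] using h)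
    ⟨fun v => h4 v v.2, by simp [reg_setReg, hw₁, Multigraph.rounds]⟩ ?_).mono ?_
  · intro j hj s₂ hF₂ h9 hI
    have hG₂ := hG₁.frame hF₂ rfl
    have h6 : s₂.reg 6 = w := by rw [hF₂.reg 6 rfl]; simpa [reg_setReg] using hw₁
    rw [Multigraph.rounds]
    refine WP.ite (fun h => WP.skip ?_) (fun h => ?_)
    · simp only [Expr.eval, h6, hI.1] at h
      rwa [if_neg h]
    · simp only [Expr.eval, h6, hI.1] at h
      rw [if_pos h, Multigraph.chipSeq_succ]
      have hG₃ := hG₂.setReg (x := 8) (c := s₂.reg 8 + s₂.reg 0) (by norm_num)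
      refine WP.seq (WP.assign (WP.seq ((wp_burn hL hG₃ (by simpa [reg_setReg] using h6)
        (by simpa [arr_setReg] using hI.1)).mono fun s₄ hF₄ h₄ => ?_)))
      refine (wp_fireUnmarked hL (hG₃.frame hF₄ rfl) h₄.1 (fun v => ?_) h₄.2).mono
        fun s₅ hF₅ h₅ => ⟨h₅, ?_⟩
      · rw [hF₄.arr 4 rfl]; exact hI.1 v
      · rw [hF₅.reg 8 rfl, hF₄.reg 8 rfl]
        simp only [reg_setReg, if_true, hI.2, hG₂.reg_zero]
        ring
  · intro s₂ hF₂ h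
    have h6 : s₂.reg 6 = w := by rw [hF₂.reg 6 rfl]; simpa [reg_setReg] using hw₁
    refine WP.store ⟨?_, fun v hv => ?_⟩
    · simp [arr_setArr, Expr.eval, h6, h.2, Multigraph.chipKey]
    · simp only [arr_setArr, Expr.eval, h6, hv, and_false, if_false]
      rw [hF₂.arr 7 rfl, arr_setReg, hF₁.arr 7 rfl]

/-- Compute the keys of all vertices. -/
def computeKeys : Program := forLoop 6 0 computeKey

theorem wp_computeKeys {D : Fin n → ℕ} (hL : n ≤ L) (hL' : n * n ≤ L)
    (hG : Represents G s) (hD : ∀ v : Fin n, s.arr 3 v = D v) :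
    WP L computeKeys s fun s' => ∀ v : Fin n, s'.arr 7 v = G.chipKey D Fin.val v := by
  refine (WP.forLoop (fun j s' => ∀ v : Fin n, v.val < j → s'.arr 7 v = G.chipKey D Fin.val v)
    n hL hG.reg_zero (by decide) rfl rfl (fun _ _ _ h => h) (by simp) ?_).mono
    fun s' _ h v => h v v.2
  intro j hj s₁ hF₁ h6 hI
  refine (wp_computeKey (w := ⟨j, hj⟩) (D := D) hL hL' (hG.frame hF₁ rfl) h6 (fun v => ?_)).mono
    fun s₂ hF₂ h v hv => ?_
  · rw [hF₁.arr 3 rfl, hD]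
  · by_cases hvj : v.val = j
    · obtain rfl : v = ⟨j, hj⟩ := Fin.ext hvj
      exact h.1
    · rw [h.2 v hvj]
      exact hI v (by omega)

/-- Compute the boundary of the current vertex. -/
def computeBoundary : Program :=
  seq (forLoop 3 0 (ite (sub (get 7 (var 6)) (get 7 (var 3)))
      (store 4 (var 3) (var 1)) (store 4 (var 3) (const 0))))
    (seq burn (forLoop 3 0 (ite (get 5 (var 3)) (store 6 (var 3) (const 0)) skip)))

/-- With the walls as thresholds, the fire is the component; its edge counts, erased on burnt
vertices, are nonzero exactly on the boundary. -/
theorem wp_computeBoundary {w : Fin n} {key : Fin n → ℕ} (hL : n ≤ L)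
    (hG : Represents G s) (hw : s.reg 6 = w) (hkey : ∀ v : Fin n, s.arr 7 v = key v) :
    WP L computeBoundary s fun s' => ∀ v : Fin n, s'.arr 6 v ≠ 0 ↔ v ∈ G.boundary key w := by
  refine WP.seq ((WP.forLoop (fun j s' => ∀ v : Fin n, v.val < j → s'.arr 4 v = G.wall key w v)
    n hL hG.reg_zero (by decide) rfl rfl (fun _ _ _ h => h) (by simp) ?_).mono ?_)
  · intro j hj s₁ hF₁ h3 hI
    have h6 : s₁.reg 6 = w := by rw [hF₁.reg 6 rfl, hw]
    have h7 : ∀ v : Fin n, s₁.arr 7 v = key v := fun v => by rw [hF₁.arr 7 rfl, hkey]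
    have h7j : s₁.arr 7 j = key ⟨j, hj⟩ := h7 ⟨j, hj⟩
    have hupd : ∀ c, c = G.wall key w ⟨j, hj⟩ → ∀ v : Fin n, v.val < j + 1 →
        (s₁.setArr 4 j c).arr 4 v = G.wall key w v := by
      rintro c rfl v hv
      simp only [arr_setArr, true_and]
      split_ifs with h
      · obtain rfl : v = ⟨j, hj⟩ := Fin.ext h
        rfl
      · exact hI v (by omega)
    refine WP.ite (fun h => WP.store ?_) (fun h => WP.store ?_)
    · simp only [Expr.eval, h3, h6, h7, h7j] at h ⊢
      refine hupd _ ?_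
      rw [(hG.frame hF₁ rfl).reg_one, Multigraph.wall, if_pos (by omega)]
    · simp only [Expr.eval, h3, h6, h7, h7j] at h ⊢
      refine hupd _ ?_
      rw [Multigraph.wall, if_neg (by omega)]
  intro s₁ hF₁ h4
  have hG₁ := hG.frame hF₁ rfl
  refine WP.seq ((wp_burn (f := G.wall key w) hL hG₁ (by rw [hF₁.reg 6 rfl, hw])
    fun v => h4 v v.2).mono fun s₂ hF₂ h₂ => ?_)
  have hG₂ := hG₁.frame hF₂ rfl
  refine (WP.forLoop (fun j s' => ∀ v : Fin n, s'.arr 6 v =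
    if v.val < j ∧ v ∈ G.lowerComp key w then 0 else G.edgesTo (G.lowerComp key w) v)
    n hL hG₂.reg_zero (by decide) rfl rfl (fun _ _ _ h => h)
    (fun v => by simpa [Multigraph.lowerComp] using h₂.2 v)
    ?_).mono ?_
  · intro j hj s₃ hF₃ h3 hI
    have h5 : s₃.arr 5 j ≠ 0 ↔ ⟨j, hj⟩ ∈ G.lowerComp key w := by
      rw [hF₃.arr 5 rfl]; exact h₂.1 ⟨j, hj⟩
    refine WP.ite (fun h => WP.store fun v => ?_) (fun h => WP.skip fun v => ?_)
    · simp only [Expr.eval, h3] at h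
      simp only [arr_setArr, Expr.eval, h3, true_and]
      by_cases hv : v.val = j
      · obtain rfl : v = ⟨j, hj⟩ := Fin.ext hv
        simp [h5.1 h]
      · have : v.val < j + 1 ↔ v.val < j := by omega
        rw [if_neg hv, hI v]
        simp only [this]
    · simp only [Expr.eval, h3] at h
      rw [hI v]
      by_cases hv : v.val = j
      · obtain rfl : v = ⟨j, hj⟩ := Fin.ext hv
        simp [mt h5.2 (not_not.2 h)]
      · have : v.val < j + 1 ↔ v.val < j := by omega
        simp only [this]
  · intro s₃ _ h v
    rw [h v, Multigraph.boundary]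
    simp [Nat.pos_iff_ne_zero]

/-! ### Writing the output -/

theorem take_finRange_succ {j : ℕ} (hj : j < n) :
    (List.finRange n).take (j + 1) = (List.finRange n).take j ++ [⟨j, hj⟩] := by
  rw [List.take_succ_eq_append_getElem (by simpa using hj)]
  simp

theorem take_finRange_self : (List.finRange n).take n = List.finRange n :=
  List.take_of_length_le (by simp)

/-- A loop over all vertices that writes a list for each of them. -/
theorem wp_forLoop_write {p : Program} {i : ℕ} (g : Fin n → List ℕ) (hL : n ≤ L)
    (h0 : s.reg 0 = n) (hi : 0 ≠ i) (hp : p.modReg 0 = false) (hpi : p.modReg i = false)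
    (hb : ∀ v : Fin n, ∀ s', Frame (forLoop i 0 p) s s' →
      s'.reg i = v → WP L p s' fun s'' => s''.out = s'.out ++ g v) :
    WP L (forLoop i 0 p) s fun s' => s'.out = s.out ++ (List.finRange n).flatMap g := by
  refine (WP.forLoop (fun j s' => s'.out = s.out ++ ((List.finRange n).take j).flatMap g) n hL h0
    hi hp hpi (fun _ _ _ h => h) (by simp) ?_).mono
    fun s' _ h => by rw [h, take_finRange_self]
  intro j hj s₁ hF₁ hij hI
  refine (hb ⟨j, hj⟩ s₁ hF₁ hij).mono fun s₂ _ h => ?_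
  rw [h, hI, take_finRange_succ hj]
  simp

/-- Write the edge from the current vertex to its parent. -/
def writeEdge : Program :=
  seq (assign 5 (const 0)) (seq
    (forLoop 4 0 (ite (get 6 (var 4)) (ite (sub (add (get 7 (var 4)) (const 1)) (var 5))
      (seq (assign 5 (add (get 7 (var 4)) (const 1))) (assign 10 (var 4))) skip) skip))
    (ite (var 5) (seq (write (var 6)) (write (var 10))) skip))

open Classical in
-- Register `5` holds the best key so far plus one, so that `0` means that no boundary vertex has
-- been seen.
theorem wp_writeEdge {w : Fin n} {key : Fin n → ℕ} (hL : n ≤ L) (hinj : Function.Injective key)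
    (hG : Represents G s) (hw : s.reg 6 = w) (hkey : ∀ v : Fin n, s.arr 7 v = key v)
    (hN : ∀ v : Fin n, s.arr 6 v ≠ 0 ↔ v ∈ G.boundary key w) :
    WP L writeEdge s fun s' => s'.out = s.out ++
      if (G.boundary key w).Nonempty then [w.val, (G.elimParent key w).val] else [] := by
  refine WP.seq (WP.assign (WP.seq ?_))
  refine (WP.forLoop (fun k s' =>
    (s'.reg 5 = 0 ∧ ∀ u : Fin n, u.val < k → u ∉ G.boundary key w) ∨
    ∃ p ∈ G.boundary key w, s'.reg 10 = p.val ∧ s'.reg 5 = key p + 1 ∧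
      ∀ u ∈ G.boundary key w, u.val < k → key u ≤ key p) n hL
    (by simpa [reg_setReg] using hG.reg_zero) (by decide) rfl rfl
    (fun k s c h => by simpa [reg_setReg] using h) (Or.inl ⟨by simp [reg_setReg, Expr.eval], by simp⟩)
    ?_).mono ?_
  · intro k hk s₁ hF₁ h4 hI
    have h7 : s₁.arr 7 k = key ⟨k, hk⟩ := by
      rw [hF₁.arr 7 rfl]; exact hkey ⟨k, hk⟩
    have h6 : s₁.arr 6 k ≠ 0 ↔ ⟨k, hk⟩ ∈ G.boundary key w := by
      rw [hF₁.arr 6 rfl]; exact hN ⟨k, hk⟩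
    have hlt : ∀ u : Fin n, u.val < k + 1 → u.val < k ∨ u = ⟨k, hk⟩ := fun u hu => by
      rw [Fin.ext_iff]; simp only; omega
    refine WP.ite (fun h => WP.ite (fun h' => WP.seq (WP.assign (WP.assign (Or.inr
      ⟨⟨k, hk⟩, ?_, ?_, ?_, fun u hu huk => ?_⟩)))) (fun h' => WP.skip ?_)) (fun h => WP.skip ?_)
    · exact h6.1 (by simpa only [Expr.eval, h4] using h)
    · simp [reg_setReg, Expr.eval, h4]
    · simp [reg_setReg, Expr.eval, h4, h7]
    · simp only [Expr.eval, h4, h7] at h'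
      rcases hlt u huk with hu' | rfl
      · rcases hI with hI | ⟨p, hp, -, h5, hmax⟩
        · exact absurd hu (hI.2 u hu')
        · have := hmax u hu hu'
          omega
      · exact le_rfl
    · simp only [Expr.eval, h4, h7] at h'
      rcases hI with hI | ⟨p, hp, h10, h5, hmax⟩
      · omega
      · refine Or.inr ⟨p, hp, h10, h5, fun u hu huk => ?_⟩
        rcases hlt u huk with hu' | rfl
        · exact hmax u hu hu'
        · omega
    · have hnot : ⟨k, hk⟩ ∉ G.boundary key w :=
        mt h6.2 (not_not.2 (by simpa only [Expr.eval, h4] using h))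
      rcases hI with ⟨h5, hI⟩ | ⟨p, hp, h10, h5, hmax⟩
      · refine Or.inl ⟨h5, fun u huk => ?_⟩
        rcases hlt u huk with hu' | rfl
        · exact hI u hu'
        · exact hnot
      · refine Or.inr ⟨p, hp, h10, h5, fun u hu huk => ?_⟩
        rcases hlt u huk with hu' | rfl
        · exact hmax u hu hu'
        · exact absurd hu hnot
  · intro s₁ hF₁ hI
    have h6 : s₁.reg 6 = w := by rw [hF₁.reg 6 rfl]; simpa [reg_setReg] using hw
    have hout : s₁.out = s.out := hF₁.out rfl
    rcases hI with ⟨h5, hI⟩ | ⟨p, hp, h10, h5, hmax⟩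
    · have hemp : ¬ (G.boundary key w).Nonempty := fun ⟨u, hu⟩ => hI u u.2 hu
      refine WP.ite (fun h => absurd h5 h) (fun _ => WP.skip ?_)
      rw [if_neg hemp, hout, List.append_nil]
    · refine WP.ite (fun _ => WP.seq (WP.write (WP.write ?_))) (fun h => ?_)
      · rw [if_pos ⟨p, hp⟩, Multigraph.elimParent_eq hinj hp fun u hu => hmax u hu u.2]
        simp [State.emit, Expr.eval, h6, h10, hout]
      · simp [Expr.eval, h5] at h

/-- The bag of `w` as a list. -/
def bagList (G : Multigraph (Fin n)) (key : Fin n → ℕ) (w : Fin n) : List (Fin n) :=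
  w :: (List.finRange n).filter (· ∈ G.boundary key w)

/-- Write the bag of the current vertex. -/
def writeBag : Program :=
  seq (assign 5 (const 1)) (seq
    (forLoop 4 0 (ite (get 6 (var 4)) (assign 5 (add (var 5) (const 1))) skip))
    (seq (write (var 5)) (seq (write (var 6))
      (forLoop 4 0 (ite (get 6 (var 4)) (write (var 4)) skip)))))

theorem wp_writeBag {w : Fin n} {key : Fin n → ℕ} (hL : n ≤ L)
    (hG : Represents G s) (hw : s.reg 6 = w)
    (hN : ∀ v : Fin n, s.arr 6 v ≠ 0 ↔ v ∈ G.boundary key w) :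
    WP L writeBag s fun s' => s'.out = s.out ++
      ((bagList G key w).length :: (bagList G key w).map Fin.val) := by
  refine WP.seq (WP.assign (WP.seq ?_))
  refine (WP.forLoop (fun k s' => s'.reg 5 =
    (((List.finRange n).take k).filter (· ∈ G.boundary key w)).length + 1) n hL
    (by simpa [reg_setReg] using hG.reg_zero) (by decide) rfl rfl
    (fun k s c h => by simpa [reg_setReg] using h) (by simp [reg_setReg, Expr.eval]) ?_).mono ?_
  · intro k hk s₁ hF₁ h4 hI
    have h6 : s₁.arr 6 k ≠ 0 ↔ ⟨k, hk⟩ ∈ G.boundary key w := by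
      rw [hF₁.arr 6 rfl]; exact hN ⟨k, hk⟩
    rw [take_finRange_succ hk, List.filter_append, List.length_append]
    refine WP.ite (fun h => WP.assign ?_) (fun h => WP.skip ?_)
    · have := h6.1 (by simpa only [Expr.eval, h4] using h)
      simp [reg_setReg, Expr.eval, hI, this]
    · have := mt h6.2 (not_not.2 (by simpa only [Expr.eval, h4] using h))
      simp [hI, this]
  · intro s₁ hF₁ hI
    have h6 : s₁.reg 6 = w := by rw [hF₁.reg 6 rfl]; simpa [reg_setReg] using hw
    have hout : s₁.out = s.out := hF₁.out rfl
    have hN₁ : ∀ v : Fin n, s₁.arr 6 v ≠ 0 ↔ v ∈ G.boundary key w := by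
      rw [hF₁.arr 6 rfl]; exact hN
    have h0 : s₁.reg 0 = n := by rw [hF₁.reg 0 rfl]; simpa [reg_setReg] using hG.reg_zero
    refine WP.seq (WP.write (WP.seq (WP.write ((wp_forLoop_write (i := 4)
      (fun v => if v ∈ G.boundary key w then [v.val] else []) hL (by exact h0) (by decide) rfl rfl
      fun v s₂ hF₂ h4 => ?_).mono fun s₂ hF₂ h => ?_))))
    · have h6' : s₂.arr 6 v ≠ 0 ↔ v ∈ G.boundary key w := by
        rw [hF₂.arr 6 rfl]; exact hN₁ v
      refine WP.ite (fun h => WP.write ?_) (fun h => WP.skip ?_)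
      · have := h6'.1 (by simpa only [Expr.eval, h4] using h)
        simp [State.emit, Expr.eval, h4, this]
      · have := mt h6'.2 (not_not.2 (by simpa only [Expr.eval, h4] using h))
        simp [this]
    · have hflat : ∀ l : List (Fin n), (l.flatMap fun v =>
          if v ∈ G.boundary key w then [v.val] else []) =
          (l.filter (· ∈ G.boundary key w)).map Fin.val := by
        intro l
        induction l with
        | nil => rfl
        | cons a l ih => by_cases ha : a ∈ G.boundary key w <;> simp [ha, ih]
      rw [h, hflat]
      rw [take_finRange_self] at hI
      simp [State.emit, Expr.eval, h6, hI, hout, bagList]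

end RAM

/-! ### The complete program -/

namespace RAM

open State RAM.Expr Program

variable {n L : ℕ} {G : Multigraph (Fin n)} {s s' : State}

theorem reg_readReg (s : State) (x y : ℕ) :
    (s.readReg x).reg y = if y = x then s.inp.headD 0 else s.reg y := by
  simp [readReg, Function.update_apply]

/-- Read the numbers of vertices and edges and compute the row offsets. -/
def readHeader : Program :=
  seq (read 0) (seq (read 1)
    (forLoop 3 0 (seq (store 0 (var 3) (var 2)) (assign 2 (add (var 2) (var 0))))))

theorem wp_readHeader {m : ℕ} {l : List ℕ} (hL : n ≤ L) (hinp : s.inp = n :: m :: l)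
    (h2 : s.reg 2 = 0) : WP L readHeader s fun s' => s'.reg 0 = n ∧ s'.reg 1 = m ∧
      s'.reg 2 = n * n ∧ (∀ u : Fin n, s'.arr 0 u = n * u) ∧ s'.inp = l := by
  refine WP.seq (WP.read (WP.seq (WP.read ?_)))
  have h0 : ((s.readReg 0).readReg 1).reg 0 = n := by simp [reg_readReg, hinp]
  -- Repeated addition tabulates the row offsets and leaves the cutoff `n * n` in register `2`.
  refine (WP.forLoop (fun j s' => s'.reg 2 = n * j ∧ ∀ u : Fin n, u.val < j → s'.arr 0 u = n * u)
    n hL h0 (by decide) rfl rfl (fun _ _ _ h => by simpa [reg_setReg, arr_setReg] using h)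
    (by simp [reg_readReg, h2]) ?_).mono ?_
  · intro j hj s₁ hF₁ h3 hI
    refine WP.seq (WP.store (WP.assign ⟨?_, fun u hu => ?_⟩))
    · simp only [reg_setReg, reg_setArr, if_true, Expr.eval, hI.1, hF₁.reg 0 rfl, h0]
      ring
    · simp only [arr_setReg, arr_setArr, Expr.eval, h3, hI.1, true_and]
      split_ifs with h
      · rw [h]
      · exact hI.2 u (by omega)
  · intro s₁ hF₁ h
    refine ⟨(hF₁.reg 0 rfl).trans h0, ?_, h.1, fun u => h.2 u u.2, ?_⟩
    · rw [hF₁.reg 1 rfl]; simp [readReg, hinp]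
    · rw [hF₁.inp rfl]; simp [readReg, hinp]

/-- Increase an array entry. -/
def incr (a : ℕ) (i : RAM.Expr) : Program := store a i (add (get a i) (const 1))

theorem wp_incr {a : ℕ} {i : RAM.Expr} {Q : State → Prop}
    (h : Q (s.setArr a (i.eval s) (s.arr a (i.eval s) + 1))) : WP L (incr a i) s Q :=
  WP.store h

/-- Read the edges and count multiplicities and degrees. -/
def readEdges : Program :=
  forLoop 7 1 (seq (read 3) (seq (read 4)
    (seq (incr 1 (add (get 0 (var 3)) (var 4))) (seq (incr 1 (add (get 0 (var 4)) (var 3)))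
      (seq (incr 2 (var 3)) (incr 2 (var 4)))))))

/-- The edges as unordered pairs. -/
def toSym2 (E : List (Fin n × Fin n)) : List (Sym2 (Fin n)) := E.map fun e => s(e.1, e.2)

theorem index_injective {a b v u : Fin n} (h : n * v.val + u.val = n * a.val + b.val) :
    v = a ∧ u = b := by
  have hpos : 0 < n := v.pos
  have h1 := congrArg (· / n) h
  have h2 := congrArg (· % n) h
  simp only [Nat.mul_add_div hpos, Nat.div_eq_of_lt u.2, Nat.div_eq_of_lt b.2,
    Nat.mul_add_mod, Nat.mod_eq_of_lt u.2, Nat.mod_eq_of_lt b.2, add_zero] at h1 h2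
  exact ⟨Fin.ext h1, Fin.ext h2⟩

theorem wp_readEdges {E : List (Fin n × Fin n)} {l : List ℕ} (hne : ∀ e ∈ E, e.1 ≠ e.2)
    (hL : E.length ≤ L) (h1 : s.reg 1 = E.length) (hoff : ∀ u : Fin n, s.arr 0 u = n * u)
    (hinp : s.inp = (E.flatMap fun e => [e.1.val, e.2.val]) ++ l)
    (ha1 : ∀ i, s.arr 1 i = 0) (ha2 : ∀ i, s.arr 2 i = 0) :
    WP L readEdges s fun s' =>
      (∀ v u : Fin n, s'.arr 1 (n * v + u) = (toSym2 E).count s(v, u)) ∧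
      (∀ v : Fin n, s'.arr 2 v = (toSym2 E).countP (v ∈ ·)) ∧ s'.inp = l := by
  refine (WP.forLoop (fun j s' =>
    (∀ v u : Fin n, s'.arr 1 (n * v + u) = (toSym2 (E.take j)).count s(v, u)) ∧
    (∀ v : Fin n, s'.arr 2 v = (toSym2 (E.take j)).countP (v ∈ ·)) ∧
    s'.inp = ((E.drop j).flatMap fun e => [e.1.val, e.2.val]) ++ l) E.length hL h1 (by decide)
    rfl rfl (fun _ _ _ h => h) (by simp [toSym2, ha1, ha2, hinp]) ?_).mono
    fun s' _ h => by simpa using h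
  rintro j hj s₁ hF₁ - ⟨hI1, hI2, hI3⟩
  set e := E[j] with he
  have hab : e.1 ≠ e.2 := hne e (List.getElem_mem hj)
  have hab' : e.1.val ≠ e.2.val := fun h => hab (Fin.ext h)
  have hoff₁ : ∀ u : Fin n, s₁.arr 0 u = n * u := fun u => by rw [hF₁.arr 0 rfl, hoff]
  have hdrop : s₁.inp = e.1.val :: e.2.val ::
      (((E.drop (j + 1)).flatMap fun e => [e.1.val, e.2.val]) ++ l) := by
    rw [hI3, List.drop_eq_getElem_cons hj, List.flatMap_cons]; rfl
  have htake : toSym2 (E.take (j + 1)) = toSym2 (E.take j) ++ [s(e.1, e.2)] := by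
    rw [List.take_succ_eq_append_getElem hj, toSym2, List.map_append]; rfl
  refine WP.seq (WP.read (WP.seq (WP.read ?_)))
  set s₂ := (s₁.readReg 3).readReg 4 with hs₂
  have h3 : s₂.reg 3 = e.1 := by simp [hs₂, reg_readReg, hdrop]
  have h4 : s₂.reg 4 = e.2 := by simp [hs₂, readReg, hdrop]
  have hinp₂ : s₂.inp = ((E.drop (j + 1)).flatMap fun e => [e.1.val, e.2.val]) ++ l := by
    simp [hs₂, readReg, hdrop]
  have harr₂ : s₂.arr = s₁.arr := rfl
  refine WP.seq (wp_incr (WP.seq (wp_incr (WP.seq (wp_incr (wp_incr ⟨fun v u => ?_, fun v => ?_,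
    hinp₂⟩))))))
  · simp only [arr_setArr, reg_setArr, Expr.eval, h3, h4, harr₂, hoff₁, hI1, htake,
      List.count_append, List.count_singleton]
    have hx : n * v.val + u.val = n * e.1.val + e.2.val ↔ v = e.1 ∧ u = e.2 :=
      ⟨index_injective, by rintro ⟨rfl, rfl⟩; rfl⟩
    have hy : n * v.val + u.val = n * e.2.val + e.1.val ↔ v = e.2 ∧ u = e.1 :=
      ⟨index_injective, by rintro ⟨rfl, rfl⟩; rfl⟩
    -- The two cells of an edge are different because it is not a loop, so neither is counted twice.
    have hz : ¬ (n * e.2.val + e.1.val = n * e.1.val + e.2.val) := fun h =>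
      hab (index_injective h).2
    by_cases c1 : v = e.1 ∧ u = e.2
    · obtain ⟨rfl, rfl⟩ := c1
      have hz' : ¬ (n * e.1.val + e.2.val = n * e.2.val + e.1.val) := fun h => hz h.symm
      simp [hz']
    · by_cases c2 : v = e.2 ∧ u = e.1
      · obtain ⟨rfl, rfl⟩ := c2
        simp [hz, hI1, Sym2.eq_swap]
      · have c3 : ¬ (s(e.1, e.2) = s(v, u)) := by
          rw [Sym2.eq_iff]
          rintro (⟨h, h'⟩ | ⟨h, h'⟩)
          · exact c1 ⟨h.symm, h'.symm⟩
          · exact c2 ⟨h'.symm, h.symm⟩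
        simp [hx, hy, c1, c2, c3]
  · simp only [arr_setArr, reg_setArr, Expr.eval, h3, h4, harr₂, htake, List.countP_append,
      List.countP_singleton]
    by_cases c1 : v = e.1
    · subst c1
      simp [hab', hI2]
    · by_cases c2 : v = e.2
      · subst c2
        simp [hab'.symm, hI2]
      · have c1' : v.val ≠ e.1.val := fun h => c1 (Fin.ext h)
        have c2' : v.val ≠ e.2.val := fun h => c2 (Fin.ext h)
        simp [c1, c2, c1', c2', hI2]

/-- Read the divisor. -/
def readDivisor : Program := forLoop 3 0 (seq (read 4) (store 3 (var 3) (var 4)))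

theorem wp_readDivisor {D : Fin n → ℕ} (hL : n ≤ L) (h0 : s.reg 0 = n)
    (hinp : s.inp = (List.finRange n).map D) :
    WP L readDivisor s fun s' => ∀ v : Fin n, s'.arr 3 v = D v := by
  refine (WP.forLoop (fun j s' => (∀ v : Fin n, v.val < j → s'.arr 3 v = D v) ∧
    s'.inp = ((List.finRange n).drop j).map D) n hL h0 (by decide)
    rfl rfl (fun _ _ _ h => h) (by simp [hinp]) ?_).mono fun s' _ h v => h.1 v v.2
  rintro j hj s₁ hF₁ h3 ⟨hI1, hI2⟩
  have hdrop : s₁.inp = D ⟨j, hj⟩ :: ((List.finRange n).drop (j + 1)).map D := by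
    rw [hI2, List.drop_eq_getElem_cons (by simpa using hj)]; simp
  refine WP.seq (WP.read (WP.store ⟨fun v hv => ?_, by simp [setArr, readReg, hdrop]⟩))
  simp only [arr_setArr, Expr.eval, reg_readReg, if_true, h3, hdrop, List.headD_cons, true_and,
    show (3 : ℕ) ≠ 4 by decide, if_false]
  split_ifs with h
  · obtain rfl : v = ⟨j, hj⟩ := Fin.ext h
    rfl
  · exact hI1 v (by omega)

/-- Write the tree and the bags. -/
def writeTree : Program :=
  seq (write (var 0)) (seq (write (sub (var 0) (const 1)))
    (seq (forLoop 6 0 (seq computeBoundary writeEdge))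
      (forLoop 6 0 (seq computeBoundary writeBag))))

open Classical in
theorem wp_writeTree {key : Fin n → ℕ} (hL : n ≤ L) (hinj : Function.Injective key)
    (hG : Represents G s) (hkey : ∀ v : Fin n, s.arr 7 v = key v) :
    WP L writeTree s fun s' => s'.out = s.out ++ ([n, n - 1] ++
      ((List.finRange n).flatMap fun w =>
        if (G.boundary key w).Nonempty then [w.val, (G.elimParent key w).val] else []) ++
      (List.finRange n).flatMap fun w =>
        (bagList G key w).length :: (bagList G key w).map Fin.val) := by
  refine WP.seq (WP.write (WP.seq (WP.write (WP.seq ?_))))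
  set s₁ := (s.emit _).emit _ with hs₁
  have hG₁ : Represents G s₁ := ⟨hG.1, hG.2, hG.3, hG.4, hG.5, hG.6⟩
  refine (wp_forLoop_write (i := 6) (fun w => if (G.boundary key w).Nonempty then
    [w.val, (G.elimParent key w).val] else []) hL hG₁.reg_zero (by decide) rfl rfl
    fun v s₂ hF₂ h6 => ?_).mono fun s₂ hF₂ h => ?_
  rotate_left
  · have hG₂ := hG₁.frame hF₂ rfl
    refine (wp_forLoop_write (i := 6) (fun w =>
      (bagList G key w).length :: (bagList G key w).map Fin.val) hL hG₂.reg_zero (by decide) rfl rfl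
      fun v s₃ hF₃ h6 => ?_).mono fun s₃ hF₃ h' => ?_
    rotate_left
    · rw [h', h]
      simp [hs₁, State.emit, Expr.eval, hG.reg_zero]
    · have hG₃ := hG₂.frame hF₃ rfl
      refine WP.seq ((wp_computeBoundary hL hG₃ h6 (key := key) fun v => ?_).mono
        fun s₄ hF₄ h₄ => ?_)
      · rw [hF₃.arr 7 rfl, hF₂.arr 7 rfl]; exact hkey v
      · refine (wp_writeBag hL (hG₃.frame hF₄ rfl) (by rw [hF₄.reg 6 rfl, h6]) h₄).mono
          fun s₅ _ h₅ => ?_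
        rw [h₅, hF₄.out rfl]
  · have hG₂ := hG₁.frame hF₂ rfl
    have hk₂ : ∀ v : Fin n, s₂.arr 7 v = key v := fun v => by
      rw [hF₂.arr 7 rfl]; exact hkey v
    refine WP.seq ((wp_computeBoundary hL hG₂ h6 hk₂).mono fun s₄ hF₄ h₄ => ?_)
    refine (wp_writeEdge hL hinj (hG₂.frame hF₄ rfl) (by rw [hF₄.reg 6 rfl, h6])
      (fun v => by rw [hF₄.arr 7 rfl]; exact hk₂ v) h₄).mono fun s₅ _ h₅ => ?_
    rw [h₅, hF₄.out rfl]

/-- The program that computes a tree decomposition from a divisor. -/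
def treeProgram : Program :=
  seq readHeader (seq readEdges (seq readDivisor (seq computeKeys writeTree)))

open Classical in
/-- The tree decomposition that the program writes. -/
noncomputable def treeOutput (G : Multigraph (Fin n)) (key : Fin n → ℕ) : TreeWithBags n where
  N := n
  treeEdges := ((List.finRange n).filter fun w => (G.boundary key w).Nonempty).map
    fun w => (w, G.elimParent key w)
  bagList := bagList G key

open Classical in
-- The announced number `n - 1` of tree edges is right because exactly one vertex, the root, has an
-- empty boundary.
theorem encode_treeOutput {key : Fin n → ℕ} (hinj : Function.Injective key) (hG : G.Connected) :
    (treeOutput G key).encode = [n, n - 1] ++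
      ((List.finRange n).flatMap fun w =>
        if (G.boundary key w).Nonempty then [w.val, (G.elimParent key w).val] else []) ++
      (List.finRange n).flatMap fun w =>
        (bagList G key w).length :: (bagList G key w).map Fin.val := by
  have hlen : (treeOutput G key).treeEdges.length = n - 1 := by
    obtain ⟨r, hr⟩ := Multigraph.exists_root hinj hG
    simp only [treeOutput, List.length_map, hr]
    have : (univ.erase r).card = n - 1 := by simp
    rw [← this, ← List.toFinset_card_of_nodup ((List.nodup_finRange n).filter _)]
    congr 1
    ext u
    simp
  have hflat : ∀ l : List (Fin n),
      (((l.filter fun w => (G.boundary key w).Nonempty).map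
        fun w => (w, G.elimParent key w)).flatMap fun f => [f.1.val, f.2.val]) =
      l.flatMap fun w =>
        if (G.boundary key w).Nonempty then [w.val, (G.elimParent key w).val] else [] := by
    intro l
    induction l with
    | nil => rfl
    | cons a l ih => by_cases ha : (G.boundary key a).Nonempty <;> simp [ha, ← ih]
  rw [TreeWithBags.encode, hlen, ← hflat]
  rfl

theorem tree_treeOutput (key : Fin n → ℕ) : (treeOutput G key).tree = G.elimTree key := by
  rw [TreeWithBags.tree, Multigraph.elimTree]
  congr 1
  ext e
  constructor
  · rintro ⟨f, hf, rfl⟩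
    obtain ⟨w, hw, rfl⟩ := List.mem_map.1 hf
    exact ⟨w, by simpa using (List.mem_filter.1 hw).2, rfl⟩
  · rintro ⟨w, hw, rfl⟩
    exact ⟨(w, G.elimParent key w), List.mem_map.2 ⟨w, List.mem_filter.2
      ⟨List.mem_finRange w, by simpa using hw⟩, rfl⟩, rfl⟩

theorem bag_treeOutput (key : Fin n → ℕ) : (treeOutput G key).bag = G.elimBag key := by
  have h : ∀ v, (bagList G key v).toFinset = G.elimBag key v := fun v => by
    ext u
    simp [bagList, Multigraph.elimBag]
  exact funext h

theorem card_edges_graph (x : DivisorInput) : x.graph.edges.card = x.edgeList.length := by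
  simp [DivisorInput.graph]

theorem mult_graph (x : DivisorInput) (v u : Fin x.n) :
    x.graph.mult v u = (toSym2 x.edgeList).count s(v, u) :=
  Multiset.coe_count _ _

theorem vertexDegree_graph (x : DivisorInput) (v : Fin x.n) :
    x.graph.vertexDegree v = (toSym2 x.edgeList).countP (v ∈ ·) := by
  simp [Multigraph.vertexDegree, DivisorInput.graph, toSym2, List.countP_eq_length_filter]

theorem wp_treeProgram {x : DivisorInput} (hL : x.n ≤ L) (hL' : x.n * x.n ≤ L)
    (hm : x.edgeList.length ≤ L) (hconn : x.graph.Connected) :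
    WP L treeProgram (State.init x.encode) fun s' => s'.out =
      (treeOutput x.graph
        (x.graph.chipKey (fun v => (x.divisor v).toNat) Fin.val)).encode := by
  refine WP.seq ((wp_readHeader hL (by simp [State.init, DivisorInput.encode]; exact ⟨rfl, rfl⟩)
    rfl).mono fun s₁ hF₁ h₁ => ?_)
  obtain ⟨h10, h11, h12, h1off, h1inp⟩ := h₁
  refine WP.seq ((wp_readEdges x.edgeList_ne hm h11 h1off h1inp (fun i => by rw [hF₁.arr 1 rfl]; rfl)
    (fun i => by rw [hF₁.arr 2 rfl]; rfl)).mono fun s₂ hF₂ h₂ => ?_)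
  have hG₂ : Represents x.graph s₂ :=
    ⟨(hF₂.reg 0 rfl).trans h10, by rw [hF₂.reg 1 rfl, h11, card_edges_graph],
      (hF₂.reg 2 rfl).trans h12, fun u => by rw [hF₂.arr 0 rfl, h1off],
      fun v u => by rw [h₂.1, mult_graph], fun v => by rw [h₂.2.1, vertexDegree_graph]⟩
  refine WP.seq ((wp_readDivisor hL hG₂.reg_zero h₂.2.2).mono fun s₃ hF₃ h₃ => ?_)
  have hG₃ := hG₂.frame hF₃ rfl
  refine WP.seq ((wp_computeKeys hL hL' hG₃ h₃).mono fun s₄ hF₄ h₄ => ?_)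
  have hinj : Function.Injective
      (x.graph.chipKey (fun v => (x.divisor v).toNat) Fin.val) :=
    Multigraph.chipKey_injective Fin.val_injective fun v => by simp
  refine (wp_writeTree hL hinj (hG₃.frame hF₄ rfl) h₄).mono fun s₅ hF₅ h₅ => ?_
  rw [h₅, encode_treeOutput hinj hconn, hF₄.out rfl, hF₃.out rfl, hF₂.out rfl, hF₁.out rfl]
  rfl

/-! ### Polynomial time -/

theorem length_le_bitSize (l : List ℕ) : l.length ≤ bitSize l := by
  induction l with
  | nil => simp
  | cons a l ih => simp only [bitSize, List.map_cons, List.sum_cons, List.length_cons] at *; omega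

theorem treeProgram_solves : treeProgram.SolvesInPolyTime DivisorInput.admissible
    DivisorInput.encode IsSmallDecomposition := by
  -- Loops run at most `n`, `n * n` or `edgeList.length` times. The encoding has `2 + 2 *
  -- edgeList.length + n` numbers, each of size at least one, so this quadratic bounds all of these.
  refine ⟨treeProgram.timePoly.comp (Polynomial.X ^ 2 + Polynomial.X), ?_⟩
  rintro x ⟨hconn, heff, hrank⟩
  have hlen : 2 + 2 * x.edgeList.length + x.n ≤ bitSize x.encode := by
    refine le_of_eq_of_le ?_ (length_le_bitSize _)
    simp [DivisorInput.encode]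
    omega
  set L := bitSize x.encode ^ 2 + bitSize x.encode with hL
  have hn2 : x.n * x.n ≤ bitSize x.encode ^ 2 := by rw [sq]; gcongr <;> omega
  obtain ⟨t, s, he, ht, hout⟩ := wp_treeProgram (L := L) (x := x) (by omega) (by omega) (by omega)
    hconn
  refine ⟨t, _, ⟨s, he, hout⟩, by simpa [Polynomial.eval_comp, hL] using ht, _, rfl, ?_⟩
  have hD : (fun v => ((x.divisor v).toNat : ℤ)) = x.divisor :=
    funext fun v => Int.toNat_of_nonneg (heff v)
  rw [tree_treeOutput, bag_treeOutput]
  refine ⟨Multigraph.elimTree_isTreeDecomposition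
    (Multigraph.chipKey_injective Fin.val_injective fun v => by simp) hconn, ?_⟩
  have hdeg : divisorDegree x.divisor = (∑ v, (x.divisor v).toNat : ℕ) := by
    rw [divisorDegree]
    conv_lhs => rw [← hD]
    push_cast
    rfl
  rw [hdeg]
  refine bagWidth_le fun i => Multigraph.card_elimBag_chipKey_le hconn (fun v => by simp) ?_ i
  rw [hD]
  exact Multigraph.reachesAll_of_rank_pos hrank

end RAM

theorem theorem2 :
    (∃ p : RAM.Program, p.SolvesInPolyTime DivisorInput.admissible DivisorInput.encode
      IsSmallDecomposition) ∧
    (∀ (V : Type*) [Fintype V] [DecidableEq V] (G : Multigraph V), G.Connected →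
      G.treewidth ≤ G.dgon) := by
  exact ⟨⟨_, RAM.treeProgram_solves⟩, fun V _ _ G hG => G.treewidth_le_dgon hG⟩
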